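/- Let $n,k,\delta$ be integers with $1\le k<n$, $\delta\ge 0$ and $(n-k)\mid\delta$. Put $\nu=\delta/(n-k)$, $L=\lfloor\delta/k\rfloor+\delta/(n-k)$ and $M=\max\{n-k,k\}$. Let $\mathbb F$ be a finite field of characteristic $p$ and let $\alpha$ be a primitive element of $\mathbb F$ (a generator of $\mathbb F^\times$). **Conventions.** A submodule $\mathcal C\subseteq\mathbb F[z]^n$ is an $(n,k,\delta)$ convolutional code if $\mathcal C=\operatorname{im}_{\mathbb F[z]}G(z)$ for some $G(z)\in\mathbb F[z]^{n\times k}$ that has a polynomial left inverse (so that $\mathcal C$ has rank $k$ and $\mathcal C=\ker_{\mathbb F[z]}H(z)$ for some $H(z)\in\mathbb F[z]^{(n-k)\times n}$) and whose full size minors have maximum degree $\delta$. For $v(z)=\sum_i v_iz^i\in\mathbb F[z]^n$ let $\mathrm{wt}(v_i)$ be the number of nonzero entries of $v_i$. The $j$-th column distance of $\mathcal C$ is $$d_j^c(\mathcal C)=\min\Big\{\sum_{i=0}^{j}\mathrm{wt}(v_i)\ :\ v(z)\in\mathcal C,\ v_0\ne 0\Big\}.$$ An $(n,k,\delta)$ convolutional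 code $\mathcal C$ is MDP (maximum distance profile) if $d_j^c(\mathcal C)=(j+1)(n-k)+1$ for all $0\le j\le L$. **Construction.** For $\ell\ge 0$ let $T_\ell\in\mathbb F^{M\times M}$ be the matrix with entries $(T_\ell)_{ij}=\alpha^{2^{M\ell+i+j-2}}$, $1\le i,j\le M$, and let $\bar H_\ell\in\mathbb F^{(n-k)\times k}$ consist of the first $n-k$ rows and the first $k$ columns of $T_\ell$. Consider matrices $A_0=I_{n-k}$ and $A_1,\dots,A_\nu\in\mathbb F^{(n-k)\times(n-k)}$ that satisfy $$ [A_{\nu}\ \cdots\ A_1]\begin{bmatrix} \bar H_{L-\nu} & \cdots & \bar H_1\\ \bar H_{L-\nu+1} & \cdots & \bar H_2\\ \vdots & & \vdots\\ \bar H_{L-1} & \cdots & \bar H_{\nu}\end{bmatrix}=-[\bar H_L\ \cdots\ \bar H_{\nu+1}] \qquad (*) $$ (no condition if $L=\nu$), and put $B_i=A_0\bar H_i+A_1\bar H_{i-1}+\cdots+A_i\bar H_0$ for $0\le i\le\nu$, $A(z)=\sum_{i=0}^{\nu}A_iz^i$ and $B(z)=\sum_{i=0}^{\nu}B_iz^i$.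 **Claim.** If $|\mathbb F|\ge p^{\,2^{M(L+1)+n-2}}$, then the system $(*)$ has a solution, and for every solution of $(*)$ the module $\mathcal C=\ker_{\mathbb F[z]}[A(z)\ \ B(z)]$ is an MDP $(n,k,\delta)$ convolutional code. -/

import Mathlib

open Polynomial

/-! ### Convolutional codes -/

/-- The maximum degree of the full size minors of an `n × k` polynomial matrix. -/
noncomputable def maxMinorDegree {F : Type*} [Field F] {n k : ℕ} (G : Matrix (Fin n) (Fin k) F[X]) : ℕ :=
  Finset.univ.sup fun s : Fin k ↪o Fin n => (G.submatrix s id).det.natDegree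

/-- `C ⊆ F[z]^n` is an `(n, k, δ)` convolutional code: it is the image of an `n × k` polynomial
matrix `G(z)` possessing a polynomial left inverse (so `C` has rank `k`), it is the kernel of an
`(n - k) × n` polynomial parity check matrix, and the maximum degree of the full size minors of
`G(z)` is `δ`. -/
def IsConvolutionalCode {F : Type*} [Field F] (n k δ : ℕ) (C : Submodule F[X] (Fin n → F[X])) :
    Prop :=
  ∃ G : Matrix (Fin n) (Fin k) F[X],
    (∃ G' : Matrix (Fin k) (Fin n) F[X], G' * G = 1) ∧
    C = LinearMap.range G.mulVecLin ∧
    (∃ H : Matrix (Fin (n - k)) (Fin n) F[X], C = LinearMap.ker H.mulVecLin) ∧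
    maxMinorDegree G = δ

/-- The coefficient vector `v_i ∈ F^n` of `v(z) = ∑ v_i z^i ∈ F[z]^n`. -/
def coeffVec {F : Type*} [Field F] {n : ℕ} (v : Fin n → F[X]) (i : ℕ) : Fin n → F :=
  fun s => (v s).coeff i

open Classical in
/-- The weight of the truncation `v_0 + v_1 z + ⋯ + v_j z^j`. -/
noncomputable def truncWeight {F : Type*} [Field F] {n : ℕ} (v : Fin n → F[X]) (j : ℕ) : ℕ :=
  ∑ i ∈ Finset.range (j + 1), hammingNorm (coeffVec v i)

/-- The `j`-th column distance of `C`: the least weight of `v_0 + ⋯ + v_j z^j` over all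
`v ∈ C` with `v_0 ≠ 0` (with value `0` if there is no such `v`). -/
noncomputable def columnDistance {F : Type*} [Field F] {n : ℕ}
    (C : Submodule F[X] (Fin n → F[X])) (j : ℕ) : ℕ :=
  sInf {w | ∃ v ∈ C, coeffVec v 0 ≠ 0 ∧ w = truncWeight v j}

/-- `L = ⌊δ / k⌋ + ⌊δ / (n - k)⌋`. -/
def profileLength (n k δ : ℕ) : ℕ := δ / k + δ / (n - k)

/-- `C` is an MDP `(n, k, δ)` convolutional code. -/
def IsMDPCode {F : Type*} [Field F] (n k δ : ℕ) (C : Submodule F[X] (Fin n → F[X])) : Prop :=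
  IsConvolutionalCode n k δ C ∧
    ∀ j ≤ profileLength n k δ, columnDistance C j = (j + 1) * (n - k) + 1

/-! ### The construction -/

/-- The `M × M` matrix `T_ℓ`, whose entry in row `i` and column `j` (counted from `0`) is
`α ^ (2 ^ (M ℓ + i + j))`. -/
def blockT {F : Type*} [Field F] (α : F) (M ℓ : ℕ) : Matrix (Fin M) (Fin M) F :=
  Matrix.of fun i j => α ^ 2 ^ (M * ℓ + (i : ℕ) + (j : ℕ))

/-- `H̄_ℓ`: the first `n - k` rows and `k` columns of `T_ℓ`, where `M = max {n - k, k}`. -/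
def blockH {F : Type*} [Field F] (α : F) (n k ℓ : ℕ) : Matrix (Fin (n - k)) (Fin k) F :=
  (blockT α (max (n - k) k) ℓ).submatrix
    (Fin.castLE (le_max_left (n - k) k)) (Fin.castLE (le_max_right (n - k) k))

/-- The block Hankel matrix with `ν` block rows and `L - ν` block columns, whose first block row is
`H_{L-ν} ⋯ H_1` and whose last block row is `H_{L-1} ⋯ H_ν`. -/
def blockHankel {F : Type*} [Field F] {r k : ℕ} (H : ℕ → Matrix (Fin r) (Fin k) F) (ν L : ℕ) :
    Matrix (Fin ν × Fin r) (Fin (L - ν) × Fin k) F :=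
  Matrix.of fun x y => H (L - ν + (x.1 : ℕ) - (y.1 : ℕ)) x.2 y.2

/-- The block row `[X_a X_{a-1} ⋯ X_{a-b+1}]` with `b` blocks. -/
def blockRow {F : Type*} [Field F] {r k : ℕ} (X : ℕ → Matrix (Fin r) (Fin k) F) (a b : ℕ) :
    Matrix (Fin r) (Fin b × Fin k) F :=
  Matrix.of fun i y => X (a - (y.1 : ℕ)) i y.2

/-- The polynomial matrix `∑_{i=0}^{ν} X_i z^i`. -/
noncomputable def polyMatrix {F : Type*} [Field F] {r k : ℕ} (X : ℕ → Matrix (Fin r) (Fin k) F)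
    (ν : ℕ) : Matrix (Fin r) (Fin k) F[X] :=
  ∑ i ∈ Finset.range (ν + 1), (Polynomial.X ^ i : F[X]) • (X i).map Polynomial.C

/-- The `(n - k) × n` matrix `[P Q]`: its first `n - k` columns are those of `P`, the last `k`
columns those of `Q`. -/
def juxtapose {R : Type*} {n k : ℕ} (hkn : k ≤ n) (P : Matrix (Fin (n - k)) (Fin (n - k)) R)
    (Q : Matrix (Fin (n - k)) (Fin k) R) : Matrix (Fin (n - k)) (Fin n) R :=
  (Matrix.fromCols P Q).submatrix id
    ((finCongr (Nat.sub_add_cancel hkn).symm).trans finSumFinEquiv.symm)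

/-! Every entry of every `H̄_ℓ` is some α^(2^m), where m is the sum of a row label and a column
label. Convexity of m ↦ 2^m means that undoing an inversion, when the zero pattern permits it,
strictly raises the exponent of a Leibniz term. So a minor of the block Hankel or block lower
triangular Toeplitz matrix of the `H̄_ℓ` that has at least one admissible term has exactly one of
largest exponent (`det_staircase_ne_zero`). It is thus a nonzero polynomial over the prime field
evaluated at α, of degree below that of the minimal polynomial of α, and does not vanish
(`aeval_primitiveRoot_ne_zero`).

For the Hankel matrix, (L - ν)k ≤ δ = ν(n - k) gives full column rank, so (*) is solvable. For the
distances, (*) says A·H̄ ≡ B mod z^(L+1), where H̄ = ∑ H̄_i z^i. As det A(0) = 1, a codeword (a, b)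
satisfies a ≡ -H̄ b mod z^(L+1), and a truncation that is too light would put the support of b in
the kernel of a nonvanishing Toeplitz minor (`le_sum_hammingNorm_of_toeplitz`).

The degree Δ of the kernel is found without examining left primeness of [A B]. A kernel over a PID
has a left invertible, column reduced generator matrix. A dimension count gives Δ ≤ (n - k)ν = δ
(`sum_colDegree_le`). If Δ were smaller than δ, the generalized Singleton bound
(`exists_truncWeight_le_singleton`) would contradict the lower bound on the L-th column distance. -/

/-! ### Dominant terms of determinants with a staircase of zeros -/

/-- The conditions `gσ`, `gτ` say that each row, in increasing order, takes the least admissible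
column not used by earlier rows. This rule determines the permutation row by row. -/
theorem greedy_perm_unique {m : ℕ} (P : Fin m → Fin m → Prop) (σ τ : Equiv.Perm (Fin m))
    (hσ : ∀ i, P i (σ i)) (hτ : ∀ i, P i (τ i))
    (gσ : ∀ i i', i < i' → σ i' < σ i → ¬ P i (σ i'))
    (gτ : ∀ i i', i < i' → τ i' < τ i → ¬ P i (τ i')) : σ = τ := by
  have key : ∀ (σ τ : Equiv.Perm (Fin m)), (∀ i, P i (τ i)) →
      (∀ i i', i < i' → σ i' < σ i → ¬ P i (σ i')) →
      ∀ i, (∀ j < i, σ j = τ j) → ¬ τ i < σ i := by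
    intro σ τ hτ gσ i ih hlt
    obtain ⟨i', hi'⟩ := σ.surjective (τ i)
    rcases lt_trichotomy i i' with h | h | h
    · exact gσ i i' h (hi' ▸ hlt) (hi' ▸ hτ i)
    · subst h; exact absurd hi' hlt.ne'
    · exact h.ne (τ.injective ((ih i' h).symm.trans hi'))
  ext i : 1
  induction i using WellFoundedLT.induction with
  | ind i ih =>
    exact le_antisymm (not_lt.1 (key σ τ hτ gσ i ih))
      (not_lt.1 (key τ σ hσ gτ i fun j hj => (ih j hj).symm))

/-- A permutation of maximal weight among those supported on an up-closed relation is greedy. -/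
theorem greedy_of_maximal {m : ℕ} (P : Fin m → Fin m → Prop) (e : Fin m → Fin m → ℕ)
    (hP : ∀ i i' j j', i ≤ i' → j ≤ j' → P i j → P i' j')
    (he : ∀ i i' j j', P i j → i < i' → j < j' → e i j' + e i' j < e i j + e i' j')
    (σ : Equiv.Perm (Fin m)) (hσ : ∀ i, P i (σ i))
    (hmax : ∀ τ : Equiv.Perm (Fin m), (∀ i, P i (τ i)) → ∑ i, e i (τ i) ≤ ∑ i, e i (σ i))
    (i i' : Fin m) (hi : i < i') (hs : σ i' < σ i) : ¬ P i (σ i') := by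
  intro hp
  -- Undoing the inversion stays admissible: row `i` by `hp`, row `i'` because `P` is up-closed. By
  -- `he` it increases the weight.
  have h1 := hmax (σ * Equiv.swap i i') (by
    intro l
    rcases eq_or_ne l i with rfl | hli
    · simpa using hp
    rcases eq_or_ne l i' with rfl | hli'
    · simpa using hP _ _ _ _ hi.le le_rfl (hσ i)
    · simpa [Equiv.swap_apply_of_ne_of_ne hli hli'] using hσ l)
  have h2 : i' ∈ Finset.univ.erase i := by simp [hi.ne']
  rw [← Finset.add_sum_erase _ _ (Finset.mem_univ i), ← Finset.add_sum_erase _ _ h2,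
    ← Finset.add_sum_erase _ (fun i => e i (σ i)) (Finset.mem_univ i),
    ← Finset.add_sum_erase _ _ h2] at h1
  have h3 : ∑ l ∈ (Finset.univ.erase i).erase i', e l ((σ * Equiv.swap i i') l) =
      ∑ l ∈ (Finset.univ.erase i).erase i', e l (σ l) := by
    refine Finset.sum_congr rfl fun l hl => ?_
    simp only [Finset.mem_erase, Finset.mem_univ, and_true] at hl
    simp [Equiv.swap_apply_of_ne_of_ne hl.2 hl.1]
  rw [h3] at h1
  simp only [Equiv.Perm.mul_apply, Equiv.swap_apply_left, Equiv.swap_apply_right] at h1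
  have := he i i' _ _ hp hi hs
  omega

theorem exists_unique_dominant_perm {m : ℕ} (P : Fin m → Fin m → Prop) (e : Fin m → Fin m → ℕ)
    (hP : ∀ i i' j j', i ≤ i' → j ≤ j' → P i j → P i' j')
    (he : ∀ i i' j j', P i j → i < i' → j < j' → e i j' + e i' j < e i j + e i' j')
    (hex : ∃ σ : Equiv.Perm (Fin m), ∀ i, P i (σ i)) :
    ∃ σ : Equiv.Perm (Fin m), (∀ i, P i (σ i)) ∧
      ∀ τ : Equiv.Perm (Fin m), (∀ i, P i (τ i)) → τ ≠ σ →
        ∑ i, e i (τ i) < ∑ i, e i (σ i) := by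
  obtain ⟨σ, hσ, hmax⟩ := Set.exists_max_image
    {σ : Equiv.Perm (Fin m) | ∀ i, P i (σ i)} (fun σ => ∑ i, e i (σ i)) (Set.toFinite _) hex
  refine ⟨σ, hσ, fun τ hτ hne => lt_of_le_of_ne (hmax τ hτ) fun heq => hne ?_⟩
  exact greedy_perm_unique P τ σ hτ hσ
    (greedy_of_maximal P e hP he τ hτ fun ρ hρ => heq ▸ hmax ρ hρ)
    (greedy_of_maximal P e hP he σ hσ hmax)

open Classical in
-- With α replaced by an indeterminate, the unique dominant permutation contributes a monomial that
-- nothing cancels, so its coefficient in the determinant is ±1. Its exponent is also the degree,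
-- which `hb` keeps below `N`.
theorem det_staircase_ne_zero {R F : Type*} [Field R] [Field F] [Algebra R F] (α : F) (N : ℕ)
    (hN : ∀ f : R[X], f ≠ 0 → f.natDegree < N → aeval α f ≠ 0)
    {m : ℕ} (P : Fin m → Fin m → Prop) (e : Fin m → Fin m → ℕ)
    (hP : ∀ i i' j j', i ≤ i' → j ≤ j' → P i j → P i' j')
    (he : ∀ i i' j j', P i j → i < i' → j < j' → e i j' + e i' j < e i j + e i' j')
    (hex : ∃ σ : Equiv.Perm (Fin m), ∀ i, P i (σ i))
    (hb : ∀ σ : Equiv.Perm (Fin m), (∀ i, P i (σ i)) → ∑ i, e i (σ i) < N) :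
    (Matrix.of fun i j => if P i j then α ^ e i j else 0).det ≠ 0 := by
  obtain ⟨σ, hσ, hmax⟩ := exists_unique_dominant_perm P e hP he hex
  set Q : Matrix (Fin m) (Fin m) R[X] := Matrix.of fun i j => if P i j then X ^ e i j else 0
    with hQ
  -- `Matrix.det_apply` lets the permutation act on rows, while `P` and `e` are indexed from row to
  -- column; hence the inverses.
  have hterm : ∀ τ : Equiv.Perm (Fin m), ∏ i, Q (τ i) i =
      if ∀ i, P i (τ.symm i) then X ^ ∑ i, e i (τ.symm i) else 0 := by
    intro τ
    have h0 : ∏ i, Q (τ i) i = ∏ i, Q i (τ.symm i) := by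
      rw [← Equiv.prod_comp τ (fun i => Q i (τ.symm i))]; simp
    rw [h0]
    split_ifs with h
    · rw [← Finset.prod_pow_eq_pow_sum]
      exact Finset.prod_congr rfl fun i _ => by simp [hQ, h i]
    · push Not at h
      obtain ⟨i, hi⟩ := h
      exact Finset.prod_eq_zero (Finset.mem_univ i) (by simp [hQ, hi])
  have hmap : (Matrix.of fun i j => if P i j then α ^ e i j else 0).det = aeval α Q.det := by
    rw [AlgHom.map_det]
    congr 1
    ext i j
    by_cases h : P i j <;> simp [hQ, h]
  rw [hmap]
  apply hN
  · intro h0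
    have hc : Q.det.coeff (∑ i, e i (σ i)) = 0 := by rw [h0]; simp
    rw [Matrix.det_apply, finsetSum_coeff, Finset.sum_eq_single σ.symm] at hc
    · rw [hterm, if_pos (by simpa using hσ)] at hc
      rcases Int.units_eq_one_or (Equiv.Perm.sign σ.symm) with h | h <;> simp_all
    · intro τ _ hτ
      rw [hterm]
      split_ifs with h
      · have := hmax τ.symm h (by rintro rfl; simp at hτ)
        rcases Int.units_eq_one_or (Equiv.Perm.sign τ) with h | h <;>
          simp [h, coeff_X_pow, this.ne']
      · simp
    · simp
  · refine lt_of_le_of_lt (natDegree_le_iff_coeff_eq_zero.2 fun d hd => ?_) (hb σ hσ)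
    rw [Matrix.det_apply, finsetSum_coeff]
    refine Finset.sum_eq_zero fun τ _ => ?_
    rw [hterm]
    split_ifs with h
    · have : ∑ i, e i (τ.symm i) < d := by
        by_cases hτ : τ.symm = σ
        · rwa [hτ]
        · exact (hmax τ.symm h hτ).trans hd
      rcases Int.units_eq_one_or (Equiv.Perm.sign τ) with h | h <;>
        simp [h, coeff_X_pow, this.ne']
    · simp

/-! ### Field size and minors with entries α^(2^m) -/

/-- A primitive element generates `F` as a field, so its minimal polynomial has degree [F : F_p],
which is at least `N` by the size of `F`. -/
theorem aeval_primitiveRoot_ne_zero {F : Type*} [Field F] [Fintype F] (p : ℕ) [Fact p.Prime]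
    [Algebra (ZMod p) F] (α : F) (hα : IsPrimitiveRoot α (Fintype.card F - 1)) (N : ℕ)
    (hN : p ^ N ≤ Fintype.card F) (f : (ZMod p)[X]) (hf : f ≠ 0) (hd : f.natDegree < N) :
    aeval α f ≠ 0 := by
  intro h0
  have hcard : 1 < Fintype.card F := Fintype.one_lt_card
  have hα0 : α ≠ 0 := hα.ne_zero (by omega)
  have hint : IsIntegral (ZMod p) α := IsIntegral.of_finite _ _
  have htop : IntermediateField.adjoin (ZMod p) {α} = ⊤ := by
    rw [eq_top_iff]
    intro x _
    by_cases hx : x = 0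
    · subst hx; exact zero_mem _
    have hx1 : x ^ (Fintype.card F - 1) = 1 := FiniteField.pow_card_sub_one_eq_one x hx
    have : NeZero (Fintype.card F - 1) := ⟨by omega⟩
    obtain ⟨i, _, rfl⟩ := hα.eq_pow_of_pow_eq_one hx1
    exact pow_mem (IntermediateField.mem_adjoin_simple_self _ _) i
  have h1 : Module.finrank (ZMod p) F = (minpoly (ZMod p) α).natDegree := by
    rw [← IntermediateField.adjoin.finrank hint, htop, IntermediateField.finrank_top']
  have h2 : Fintype.card F = p ^ Module.finrank (ZMod p) F := by
    rw [Module.card_eq_pow_finrank (K := ZMod p) (V := F), ZMod.card]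
  have h3 : (minpoly (ZMod p) α).natDegree ≤ f.natDegree :=
    natDegree_le_natDegree (minpoly.degree_le_of_ne_zero _ _ hf h0)
  have h4 := (Nat.pow_le_pow_iff_right (Fact.out : p.Prime).one_lt).1 (h2 ▸ hN)
  omega

theorem two_pow_sub_supermodular {c x x' y y' : ℕ} (hc : c ≤ x + y) (hx : x < x') (hy : y < y') :
    2 ^ (x + y' - c) + 2 ^ (x' + y - c) < 2 ^ (x + y - c) + 2 ^ (x' + y' - c) := by
  obtain ⟨u, hu⟩ := Nat.exists_eq_add_of_le hc
  obtain ⟨a, rfl⟩ := Nat.exists_eq_add_of_lt hx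
  obtain ⟨b, rfl⟩ := Nat.exists_eq_add_of_lt hy
  have e1 : x + (y + b + 1) - c = u + (b + 1) := by omega
  have e2 : x + a + 1 + y - c = u + (a + 1) := by omega
  have e3 : x + y - c = u := by omega
  have e4 : x + a + 1 + (y + b + 1) - c = u + ((a + 1) + (b + 1)) := by omega
  rw [e1, e2, e3, e4]
  simp only [pow_add 2 u, pow_add 2 (a + 1)]
  have ha : 2 ≤ 2 ^ (a + 1) := by rw [pow_succ]; have := Nat.one_le_two_pow (n := a); omega
  have hb : 2 ≤ 2 ^ (b + 1) := by rw [pow_succ]; have := Nat.one_le_two_pow (n := b); omega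
  have hu : 0 < 2 ^ u := by positivity
  have : 2 ^ (b + 1) + 2 ^ (a + 1) < 1 + 2 ^ (a + 1) * 2 ^ (b + 1) := by nlinarith
  nlinarith

/-- Distinct powers of 2 add up as binary digits; this keeps the degree bound independent of the
size of the minor. -/
theorem sum_two_pow_lt {m : ℕ} (x : Fin m ↪o ℕ) (X : ℕ) (hx : ∀ i, x i ≤ X) :
    ∑ i, 2 ^ x i < 2 ^ (X + 1) := by
  have := Nat.geomSum_lt (m := 2) (n := X + 1) (s := Finset.univ.map x.toEmbedding) le_rfl
    (by simp only [Finset.mem_map, Finset.mem_univ, true_and]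
        rintro _ ⟨i, rfl⟩; exact Nat.lt_succ_of_le (hx i))
  simpa using this

/-- The matrix with rows `S`, columns `T` and entries `α ^ 2 ^ (x + y - M J)` for
`J ≤ x / M + y / M` (and `0` otherwise) has trivial kernel if its determinant is not trivially
zero. -/
theorem eq_zero_of_staircase {R F : Type*} [Field R] [Field F] [Algebra R F] (α : F) (E : ℕ)
    (hN : ∀ f : R[X], f ≠ 0 → f.natDegree < 2 ^ E → aeval α f ≠ 0)
    (M J xm ym : ℕ) (S T : Finset ℕ) (hcard : S.card = T.card)
    (hxm : ∀ x ∈ S, x ≤ xm) (hym : ∀ y ∈ T, y ≤ ym) (hE : xm + ym + 1 ≤ E + M * J)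
    (hall : ∀ s < J, (S.filter fun x => x / M ≤ s).card ≤ (T.filter fun y => J ≤ s + y / M).card)
    (β : ℕ → F)
    (hβ : ∀ x ∈ S, ∑ y ∈ T, (if J ≤ x / M + y / M then α ^ 2 ^ (x + y - M * J) else 0) * β y = 0) :
    ∀ y ∈ T, β y = 0 := by
  classical
  have hle : ∀ a b, J ≤ a / M + b / M → M * J ≤ a + b := by
    intro a b h
    calc M * J ≤ M * (a / M + b / M) := Nat.mul_le_mul_left _ h
      _ = M * (a / M) + M * (b / M) := by ring
      _ ≤ a + b := Nat.add_le_add (Nat.mul_div_le _ _) (Nat.mul_div_le _ _)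
  set w := T.card with hw
  set x := S.orderEmbOfFin hcard with hx
  set y := T.orderEmbOfFin hw.symm with hy
  have hxS : ∀ i, x i ∈ S := fun i => Finset.orderEmbOfFin_mem _ _ i
  have hyT : ∀ i, y i ∈ T := fun i => Finset.orderEmbOfFin_mem _ _ i
  have hdet := det_staircase_ne_zero α (2 ^ E) hN
    (fun i j : Fin w => J ≤ x i / M + y j / M) (fun i j => 2 ^ (x i + y j - M * J))
    (fun i i' j j' hi hj h => h.trans (Nat.add_le_add
      (Nat.div_le_div_right (x.monotone hi)) (Nat.div_le_div_right (y.monotone hj))))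
    (fun i i' j j' h hi hj =>
      two_pow_sub_supermodular (hle _ _ h) (x.strictMono hi) (y.strictMono hj))
    -- The antidiagonal is admissible. If it failed at row `i` in block `s`, all columns with J ≤ s
    -- + y / M would lie strictly after `i.rev`, so at most `i` of them exist, whereas at least `i +
    -- 1` rows have block ≤ `s`, against `hall`.
    ⟨Fin.revPerm, fun i => by
      by_contra! hlt
      simp only [Fin.revPerm_apply] at hlt
      set s := x i / M with hs
      have h1 : (i : ℕ) + 1 ≤ (S.filter fun x => x / M ≤ s).card := by
        have : ((Finset.Iic i).map x.toEmbedding) ⊆ S.filter fun x => x / M ≤ s := by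
          intro a ha
          simp only [Finset.mem_map, Finset.mem_Iic, Finset.mem_filter] at ha ⊢
          obtain ⟨l, hl, rfl⟩ := ha
          exact ⟨hxS l, Nat.div_le_div_right (x.monotone hl)⟩
        simpa using Finset.card_le_card this
      have h2 : (T.filter fun y => J ≤ s + y / M).card ≤ i := by
        have : (T.filter fun y => J ≤ s + y / M) ⊆ (Finset.Ioi i.rev).map y.toEmbedding := by
          intro b hb
          simp only [Finset.mem_map, Finset.mem_Ioi, Finset.mem_filter] at hb ⊢
          have hbr : b ∈ Set.range y := by rw [Finset.range_orderEmbOfFin]; exact hb.1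
          obtain ⟨l, rfl⟩ := hbr
          refine ⟨l, ?_, rfl⟩
          by_contra! hl
          have := Nat.div_le_div_right (c := M) (y.monotone hl)
          omega
        have := Finset.card_le_card this
        simp only [Finset.card_map, Fin.card_Ioi, Fin.val_rev] at this
        have := i.2
        omega
      have := hall s ((Nat.le_add_right _ _).trans_lt hlt)
      omega⟩
    (fun σ hσ => by
      -- Multiplying by 2^(MJ) clears the truncated subtraction. Column labels are then bounded by
      -- `ym`, and only the distinctness of row labels is used.
      have h1 : (∑ i, 2 ^ (x i + y (σ i) - M * J)) * 2 ^ (M * J) < 2 ^ E * 2 ^ (M * J) := by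
        rw [Finset.sum_mul]
        calc ∑ i, 2 ^ (x i + y (σ i) - M * J) * 2 ^ (M * J)
            ≤ ∑ i, 2 ^ x i * 2 ^ ym := Finset.sum_le_sum fun i _ => by
              rw [← pow_add, ← pow_add, Nat.sub_add_cancel (hle _ _ (hσ i))]
              exact Nat.pow_le_pow_right two_pos (Nat.add_le_add_left (hym _ (hyT _)) _)
          _ = (∑ i, 2 ^ x i) * 2 ^ ym := by rw [Finset.sum_mul]
          _ < 2 ^ (xm + 1) * 2 ^ ym :=
              Nat.mul_lt_mul_of_pos_right (sum_two_pow_lt x xm fun i => hxm _ (hxS i))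
                (by positivity)
          _ ≤ _ := by
              rw [← pow_add, ← pow_add]
              exact Nat.pow_le_pow_right two_pos (by omega)
      exact lt_of_mul_lt_mul_right h1 (Nat.zero_le _))
  have hv := Matrix.eq_zero_of_mulVec_eq_zero hdet (v := fun j => β (y j)) (by
    ext i
    simp only [Matrix.mulVec, dotProduct, Matrix.of_apply, Pi.zero_apply]
    refine Eq.trans ?_ (hβ (x i) (hxS i))
    have hT : T = Finset.univ.map y.toEmbedding := by
      rw [hy]; simp
    conv_rhs => rw [hT]
    rw [Finset.sum_map]
    refine Finset.sum_congr rfl fun j _ => ?_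
    simp)
  intro b hb
  have hbr : b ∈ Set.range y := by rw [Finset.range_orderEmbOfFin]; exact hb
  obtain ⟨l, rfl⟩ := hbr
  exact congrFun hv l

theorem eq_zero_of_staircase_of_injOn {R F : Type*} [Field R] [Field F] [Algebra R F] (α : F)
    (E : ℕ) (hN : ∀ f : R[X], f ≠ 0 → f.natDegree < 2 ^ E → aeval α f ≠ 0)
    {ι κ : Type*} (M J xm ym : ℕ) (S : Finset ι) (T : Finset κ) (hcard : S.card = T.card)
    (φ : ι → ℕ) (ψ : κ → ℕ) (hφ : Set.InjOn φ S) (hψ : Set.InjOn ψ T)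
    (hxm : ∀ x ∈ S, φ x ≤ xm) (hym : ∀ y ∈ T, ψ y ≤ ym) (hE : xm + ym + 1 ≤ E + M * J)
    (hall : ∀ s < J, (S.filter fun x => φ x / M ≤ s).card ≤
      (T.filter fun y => J ≤ s + ψ y / M).card)
    (b : κ → F)
    (hb : ∀ x ∈ S, ∑ y ∈ T,
      (if J ≤ φ x / M + ψ y / M then α ^ 2 ^ (φ x + ψ y - M * J) else 0) * b y = 0) :
    ∀ y ∈ T, b y = 0 := by
  classical
  intro y hy
  have : Nonempty κ := ⟨y⟩
  have hinv : ∀ y ∈ T, Function.invFunOn ψ T (ψ y) = y := fun y hy =>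
    hψ.leftInvOn_invFunOn hy
  have hS : ∀ p : ℕ → Prop, [DecidablePred p] →
      ((S.image φ).filter p).card = (S.filter fun x => p (φ x)).card := fun p _ => by
    rw [Finset.filter_image, Finset.card_image_of_injOn (hφ.mono fun x hx => (Finset.mem_filter.1 hx).1)]
  have hT : ∀ p : ℕ → Prop, [DecidablePred p] →
      ((T.image ψ).filter p).card = (T.filter fun x => p (ψ x)).card := fun p _ => by
    rw [Finset.filter_image, Finset.card_image_of_injOn (hψ.mono fun x hx => (Finset.mem_filter.1 hx).1)]
  have key := eq_zero_of_staircase α E hN M J xm ym (S.image φ) (T.image ψ)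
    (by rw [Finset.card_image_of_injOn hφ, Finset.card_image_of_injOn hψ, hcard])
    (by simpa using hxm) (by simpa using hym) hE
    (fun s hs => by rw [hS, hT]; exact hall s hs)
    (fun z => b (Function.invFunOn ψ T z)) (by
      intro z hz
      obtain ⟨x, hx, rfl⟩ := Finset.mem_image.1 hz
      rw [Finset.sum_image hψ]
      refine Eq.trans ?_ (hb x hx)
      exact Finset.sum_congr rfl fun y hy => by rw [hinv y hy])
  have := key (ψ y) (Finset.mem_image_of_mem _ hy)
  rwa [hinv y hy] at this

/-! ### Solvability of the Hankel system -/

theorem blockH_apply {F : Type*} [Field F] (α : F) (n k ℓ : ℕ) (i : Fin (n - k)) (c : Fin k) :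
    blockH α n k ℓ i c = α ^ 2 ^ (max (n - k) k * ℓ + i + c) := rfl

/-- Any choice of (L - ν)k rows gives an invertible square matrix. There is no zero pattern here, so
the staircase lemma is applied with J = 0 and its counting condition is void. -/
theorem blockHankel_mulVec_injective {R F : Type*} [Field R] [Field F] [Algebra R F] (α : F)
    (E : ℕ) (hN : ∀ f : R[X], f ≠ 0 → f.natDegree < 2 ^ E → aeval α f ≠ 0)
    (n k ν L : ℕ) (hk : 0 < k) (hkn : k < n) (hνL : (L - ν) * k ≤ ν * (n - k))
    (hE : max (n - k) k * L + (n - 1) ≤ E) :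
    Function.Injective (blockHankel (blockH α n k) ν L).mulVec := by
  set M := max (n - k) k with hM
  have hrM : n - k ≤ M := le_max_left _ _
  have hkM : k ≤ M := le_max_right _ _
  rw [← Matrix.coe_mulVecLin, injective_iff_map_eq_zero]
  intro b hb
  obtain ⟨S, -, hS⟩ := Finset.exists_subset_card_eq
    (s := (Finset.univ : Finset (Fin ν × Fin (n - k)))) (n := (L - ν) * k)
    (by simpa using hνL)
  have inj : ∀ {m q : ℕ} (f : Fin q → ℕ) (hf : Function.Injective f) (hm : m ≤ M),
      Function.Injective fun x : Fin q × Fin m => M * f x.1 + x.2 := by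
    rintro m q f hf hm ⟨x, i⟩ ⟨x', i'⟩ h
    have hi := i.2.trans_le hm
    have hi' := i'.2.trans_le hm
    simp only at h
    have h1 : f x = f x' := by
      have := congrArg (· / M) h
      simpa [Nat.mul_add_div (hk.trans_le hkM), Nat.div_eq_of_lt hi, Nat.div_eq_of_lt hi']
        using this
    have h2 : (i : ℕ) = i' := by rw [h1] at h; omega
    exact Prod.ext (hf h1) (Fin.ext h2)
  have key := eq_zero_of_staircase_of_injOn α E hN M 0 (M * ν + (n - k - 1))
    (M * (L - ν - 1) + (k - 1)) S
    (Finset.univ : Finset (Fin (L - ν) × Fin k)) (by simpa using hS)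
    -- Block columns are reversed so that the labels add up to the Hankel exponent; the shift by 1
    -- in the rows makes up for L - ν - 1.
    (fun x => M * ((x.1 : ℕ) + 1) + x.2) (fun y => M * (L - ν - 1 - (y.1 : ℕ)) + y.2)
    ((inj (fun x : Fin ν => (x : ℕ) + 1)
      (fun a b h => Fin.ext (Nat.succ_injective h)) hrM).injOn)
    ((inj (fun y : Fin (L - ν) => L - ν - 1 - (y : ℕ))
      (fun a b h => Fin.ext (by have := a.2; have := b.2; simp only at h; omega)) hkM).injOn)
    (fun x _ => Nat.add_le_add (Nat.mul_le_mul_left _ x.1.2) (Nat.le_sub_one_of_lt x.2.2))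
    (fun y _ => Nat.add_le_add (Nat.mul_le_mul_left _ (Nat.sub_le _ _))
      (Nat.le_sub_one_of_lt y.2.2))
  by_cases hLν : L - ν = 0
  · ext y
    exact absurd y.1.2 (by omega)
  ext y
  refine key ?_ (by simp) b ?_ y (Finset.mem_univ y)
  · have : M * ν + M * (L - ν - 1) ≤ M * L := by
      rw [← mul_add]; exact Nat.mul_le_mul_left _ (by omega)
    omega
  · intro x _
    refine Eq.trans ?_ (congrFun hb x)
    simp only [Matrix.mulVecLin_apply, Matrix.mulVec, dotProduct]
    refine Finset.sum_congr rfl fun y _ => ?_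
    simp only [Nat.zero_le, if_true, mul_zero, Nat.sub_zero, blockHankel, Matrix.of_apply,
      blockH_apply]
    congr 3
    obtain ⟨d, hd⟩ := Nat.exists_eq_add_of_lt y.1.2
    have e1 : L - ν - 1 - (y.1 : ℕ) = d := by omega
    have e2 : L - ν + (x.1 : ℕ) - y.1 = (x.1 : ℕ) + 1 + d := by omega
    rw [e1, e2, ← hM]
    ring

theorem exists_blockRow_mul_eq {F : Type*} [Field F] {r ν : ℕ} {κ : Type*} [Fintype κ]
    [DecidableEq κ]
    (K : Matrix (Fin ν × Fin r) κ F) (hK : Function.Injective K.mulVec)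
    (Y : Matrix (Fin r) κ F) :
    ∃ A : ℕ → Matrix (Fin r) (Fin r) F, A 0 = 1 ∧ blockRow A ν ν * K = Y := by
  obtain ⟨g, hg⟩ := LinearMap.exists_leftInverse_of_injective K.mulVecLin
    (LinearMap.ker_eq_bot.2 hK)
  have hg' : LinearMap.toMatrix' g * K = 1 := by
    have := congrArg LinearMap.toMatrix' hg
    rwa [LinearMap.toMatrix'_comp, LinearMap.toMatrix'_id, ← Matrix.toLin'_apply',
      LinearMap.toMatrix'_toLin'] at this
  set Z : Matrix (Fin r) (Fin ν × Fin r) F := Y * LinearMap.toMatrix' g with hZ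
  -- The blocks of a block row run from A_ν down to A_1, so A_s is block ν - s. The default 1
  -- supplies A_0.
  refine ⟨fun s => if h : 0 < s ∧ s ≤ ν then Matrix.of fun i c => Z i (⟨ν - s, by omega⟩, c)
    else 1, by simp, ?_⟩
  have : blockRow (fun s => if h : 0 < s ∧ s ≤ ν then
      Matrix.of fun i c => Z i (⟨ν - s, by omega⟩, c) else 1) ν ν = Z := by
    ext i y
    have hy := y.1.2
    simp only [blockRow, Matrix.of_apply]
    rw [dif_pos ⟨by omega, by omega⟩]
    simp only [Matrix.of_apply]
    congr 1
    refine Prod.ext (Fin.ext ?_) rfl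
    simp only
    omega
  rw [this, hZ, Matrix.mul_assoc, hg', Matrix.mul_one]

/-! ### Weight growth from the Toeplitz matrix -/

theorem card_filter_range_product {m q : ℕ} (P : ℕ → Fin q → Prop) [∀ i c, Decidable (P i c)] :
    ((Finset.range m ×ˢ Finset.univ).filter fun x : ℕ × Fin q => P x.1 x.2).card =
      ∑ i ∈ Finset.range m, (Finset.univ.filter (P i)).card := by
  rw [Finset.card_filter, Finset.sum_product]
  exact Finset.sum_congr rfl fun i _ => (Finset.card_filter _ _).symm

/-- Labelling columns with block J - t instead of t turns the Toeplitz matrix into the staircase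
form: the admissibility condition becomes t ≤ block of the row, and the exponents agree after
subtracting MJ. -/
theorem eq_zero_of_toeplitz {R F : Type*} [Field R] [Field F] [Algebra R F] (α : F)
    (E : ℕ) (hN : ∀ f : R[X], f ≠ 0 → f.natDegree < 2 ^ E → aeval α f ≠ 0)
    (n k J : ℕ) (hk : 0 < k) (hkn : k < n) (hE : max (n - k) k * J + (n - 1) ≤ E)
    (S : Finset (ℕ × Fin (n - k))) (T : Finset (ℕ × Fin k)) (hcard : S.card = T.card)
    (hSJ : ∀ x ∈ S, x.1 ≤ J) (hTJ : ∀ y ∈ T, y.1 ≤ J)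
    (hall : ∀ s < J, (S.filter fun x => x.1 ≤ s).card ≤ (T.filter fun y => y.1 ≤ s).card)
    (b : ℕ → Fin k → F) (hbT : ∀ t ≤ J, ∀ c, (t, c) ∉ T → b t c = 0)
    (hb : ∀ x ∈ S, (∑ t ∈ Finset.range (x.1 + 1), (blockH α n k (x.1 - t)).mulVec (b t)) x.2 = 0) :
    ∀ y ∈ T, b y.1 y.2 = 0 := by
  classical
  set M := max (n - k) k with hM
  have hrM : n - k ≤ M := le_max_left _ _
  have hkM : k ≤ M := le_max_right _ _
  have hdiv : ∀ {m : ℕ} (hm : m ≤ M) (a : ℕ) (i : Fin m), (M * a + i) / M = a := by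
    intro m hm a i
    rw [Nat.mul_add_div (hk.trans_le hkM), Nat.div_eq_of_lt (i.2.trans_le hm), add_zero]
  have hinj : ∀ {m : ℕ} (hm : m ≤ M) {a a' : ℕ} {i i' : Fin m}, M * a + i = M * a' + i' →
      a = a' ∧ i = i' := by
    intro m hm a a' i i' h
    have h1 : a = a' := by rw [← hdiv hm a i, h, hdiv hm]
    subst h1
    exact ⟨rfl, Fin.ext (by omega)⟩
  refine eq_zero_of_staircase_of_injOn α E hN M J (M * J + (n - k - 1)) (M * J + (k - 1)) S T hcard
    (fun x => M * x.1 + x.2) (fun y => M * (J - y.1) + y.2)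
    (fun x _ x' _ h => Prod.ext (hinj hrM h).1 (hinj hrM h).2)
    (fun y hy y' hy' h => Prod.ext
      (by have := (hinj hkM h).1; have := hTJ y hy; have := hTJ y' hy'; omega) (hinj hkM h).2)
    (fun x hx => Nat.add_le_add (Nat.mul_le_mul_left _ (hSJ x hx)) (Nat.le_sub_one_of_lt x.2.2))
    (fun y _ => Nat.add_le_add (Nat.mul_le_mul_left _ (Nat.sub_le _ _))
      (Nat.le_sub_one_of_lt y.2.2))
    (by omega) ?_ (fun y => b y.1 y.2) ?_
  · intro s hs
    simp only [hdiv hrM, hdiv hkM]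
    refine (hall s hs).trans (Finset.card_le_card fun y hy => ?_)
    simp only [Finset.mem_filter] at hy ⊢
    exact ⟨hy.1, by omega⟩
  · intro x hx
    refine Eq.trans ?_ (hb x hx)
    have hxJ := hSJ x hx
    simp only [hdiv hrM, hdiv hkM]
    have hsub : T ⊆ Finset.range (J + 1) ×ˢ Finset.univ := fun y hy => by
      simpa using Nat.lt_succ_of_le (hTJ y hy)
    rw [Finset.sum_subset hsub fun y hy hyT => by
      simp only [Finset.mem_product, Finset.mem_range, Finset.mem_univ, and_true] at hy
      rw [hbT y.1 (by omega) y.2 hyT, mul_zero], Finset.sum_product, Finset.sum_apply,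
      ← Finset.sum_subset (Finset.range_mono (Nat.succ_le_succ hxJ))]
    · refine Finset.sum_congr rfl fun t ht => ?_
      simp only [Finset.mem_range] at ht
      simp only [Matrix.mulVec, dotProduct, blockH_apply]
      refine Finset.sum_congr rfl fun c _ => ?_
      rw [if_pos (by omega)]
      congr 3
      obtain ⟨d, hd⟩ := Nat.exists_eq_add_of_le (Nat.le_of_lt_succ ht)
      obtain ⟨u, hu⟩ := Nat.exists_eq_add_of_le hxJ
      have e1 : J - t = d + u := by omega
      have e2 : x.1 - t = d := by omega
      rw [e1, e2, ← hM, hu, hd]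
      apply Nat.sub_eq_of_eq_add
      ring
    · intro t ht ht'
      simp only [Finset.mem_range] at ht ht'
      refine Finset.sum_eq_zero fun c _ => ?_
      rw [if_neg (by omega), zero_mul]

open Classical in
/-- The sliding parity-check matrix of the construction yields the maximal weight growth. -/
theorem le_sum_hammingNorm_of_toeplitz {R F : Type*} [Field R] [Field F] [Algebra R F] (α : F)
    (E : ℕ) (hN : ∀ f : R[X], f ≠ 0 → f.natDegree < 2 ^ E → aeval α f ≠ 0)
    (n k L : ℕ) (hk : 0 < k) (hkn : k < n) (hE : max (n - k) k * L + (n - 1) ≤ E)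
    (a : ℕ → Fin (n - k) → F) (b : ℕ → Fin k → F)
    (hab : ∀ i ≤ L, a i + ∑ t ∈ Finset.range (i + 1), (blockH α n k (i - t)).mulVec (b t) = 0)
    (hb0 : b 0 ≠ 0) (j : ℕ) (hj : j ≤ L) :
    (j + 1) * (n - k) + 1 ≤ ∑ i ∈ Finset.range (j + 1), (hammingNorm (a i) + hammingNorm (b i)) := by
  induction j using Nat.strong_induction_on with
  | _ j ih =>
  by_contra! hlt
  have hzero : ∀ s, ∑ i ∈ Finset.range s, (Finset.univ.filter fun c => a i c = 0).card +
      ∑ i ∈ Finset.range s, hammingNorm (a i) = s * (n - k) := by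
    intro s
    rw [← Finset.sum_add_distrib]
    simp only [hammingNorm, Finset.card_filter_add_card_filter_not]
    simp
  set Z := (Finset.range (j + 1) ×ˢ Finset.univ).filter
    fun x : ℕ × Fin (n - k) => a x.1 x.2 = 0 with hZ
  set T := (Finset.range (j + 1) ×ˢ Finset.univ).filter
    fun x : ℕ × Fin k => b x.1 x.2 ≠ 0 with hT
  have hZc : Z.card = ∑ i ∈ Finset.range (j + 1), (Finset.univ.filter fun c => a i c = 0).card :=
    card_filter_range_product fun i c => a i c = 0
  have hTc : T.card = ∑ i ∈ Finset.range (j + 1), hammingNorm (b i) :=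
    card_filter_range_product fun i c => b i c ≠ 0
  have hle : T.card ≤ Z.card := by
    have := hzero (j + 1)
    rw [Finset.sum_add_distrib] at hlt
    omega
  -- A light truncation makes a vanish in at least as many places as b is nonzero. Rows at zeros of
  -- a and columns in the support of b form a square system that kills b.
  obtain ⟨S, hSZ, hS⟩ := Finset.exists_subset_card_eq hle
  have hz := eq_zero_of_toeplitz α E hN n k j hk hkn
    (le_trans (Nat.add_le_add_right (Nat.mul_le_mul_left _ hj) _) hE) S T hS
    (fun x hx => by have := hSZ hx; simp only [hZ, Finset.mem_filter, Finset.mem_product,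
      Finset.mem_range] at this; omega)
    (fun x hx => by simp only [hT, Finset.mem_filter, Finset.mem_product,
      Finset.mem_range] at hx; omega)
    (fun s hs => by
      have h1 : (S.filter fun x => x.1 ≤ s).card ≤
          ∑ i ∈ Finset.range (s + 1), (Finset.univ.filter fun c => a i c = 0).card := by
        rw [← card_filter_range_product fun i c => a i c = 0]
        refine Finset.card_le_card fun x hx => ?_
        have h2 := (Finset.mem_filter.1 (hSZ (Finset.mem_filter.1 hx).1)).2
        have h3 := (Finset.mem_filter.1 hx).2
        simp only [Finset.mem_filter, Finset.mem_product, Finset.mem_range, Finset.mem_univ]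
        exact ⟨⟨by omega, trivial⟩, h2⟩
      have h2 : ∑ i ∈ Finset.range (s + 1), hammingNorm (b i) ≤
          (T.filter fun x => x.1 ≤ s).card := by
        rw [show ∑ i ∈ Finset.range (s + 1), hammingNorm (b i) = _ from
          (card_filter_range_product fun i c => b i c ≠ 0).symm]
        refine Finset.card_le_card fun x hx => ?_
        simp only [hT, Finset.mem_filter, Finset.mem_product, Finset.mem_range, Finset.mem_univ]
          at hx ⊢
        exact ⟨⟨⟨by omega, trivial⟩, hx.2⟩, by omega⟩
      -- The counting condition is the bound for the shorter truncation: up to time `s`, a has fewer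
      -- zeros than b has nonzero entries.
      have h3 := ih s hs (by omega)
      rw [Finset.sum_add_distrib] at h3
      have := hzero (s + 1)
      omega)
    b (fun t ht c htc => by
      by_contra h
      exact htc (by simp [hT, h, Nat.lt_succ_of_le ht]))
    (fun x hx => by
      have h1 := hSZ hx
      simp only [hZ, Finset.mem_filter, Finset.mem_product, Finset.mem_range] at h1
      have h2 := congrFun (hab x.1 (by omega)) x.2
      simpa [h1.2] using h2)
  apply hb0
  ext c
  by_contra h
  exact h (hz (0, c) (by simp [hT]; exact h))

/-! ### From the parity check matrix to the Toeplitz relation -/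

theorem coeff_mulVec_eq_sum {F : Type*} [Field F] {r k : ℕ} (P : Matrix (Fin r) (Fin k) F[X])
    (v : Fin k → F[X]) (t : ℕ) (i : Fin r) :
    (P.mulVec v i).coeff t = ∑ s ∈ Finset.range (t + 1),
      (P.map fun f => f.coeff (t - s)).mulVec (fun c => (v c).coeff s) i := by
  simp only [Matrix.mulVec, dotProduct, finsetSum_coeff, Matrix.map_apply]
  rw [Finset.sum_comm]
  refine Finset.sum_congr rfl fun c _ => ?_
  rw [mul_comm, coeff_mul, Finset.Nat.sum_antidiagonal_eq_sum_range_succ_mk]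
  exact Finset.sum_congr rfl fun s _ => mul_comm _ _

theorem coeff_polyMatrix {F : Type*} [Field F] {r k : ℕ} (Y : ℕ → Matrix (Fin r) (Fin k) F)
    (ν t : ℕ) (i : Fin r) (c : Fin k) :
    (polyMatrix Y ν i c).coeff t = if t ≤ ν then Y t i c else 0 := by
  simp only [polyMatrix, Matrix.sum_apply, Matrix.smul_apply, Matrix.map_apply, smul_eq_mul,
    finsetSum_coeff, coeff_X_pow_mul', coeff_C]
  split_ifs with h
  · rw [Finset.sum_eq_single t]
    · simp
    · intro s _ hs
      split_ifs with h1 h2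
      · omega
      · rfl
      · rfl
    · intro h1; exact absurd (Finset.mem_range.2 (Nat.lt_succ_of_le h)) h1
  · refine Finset.sum_eq_zero fun s hs => ?_
    simp only [Finset.mem_range] at hs
    rw [if_pos (by omega), if_neg (by omega)]

theorem isCoprime_X_pow_det {F : Type*} [Field F] {r : ℕ} (P : Matrix (Fin r) (Fin r) F[X])
    (hP : (P.map fun f => f.coeff 0) = 1) (m : ℕ) : IsCoprime (X ^ m) P.det := by
  have h : P.det.coeff 0 = 1 := by
    rw [← constantCoeff_apply, RingHom.map_det]
    rw [show (constantCoeff : F[X] →+* F).mapMatrix P = 1 from hP, Matrix.det_one]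
  refine IsCoprime.pow_left ?_
  rw [prime_X.coprime_iff_not_dvd, X_dvd_iff, h]
  exact one_ne_zero

theorem polyMatrix_coeff_zero {F : Type*} [Field F] {r : ℕ} (A : ℕ → Matrix (Fin r) (Fin r) F)
    (hA : A 0 = 1) (ν : ℕ) : ((polyMatrix A ν).map fun f => f.coeff 0) = 1 := by
  ext i c
  simp [coeff_polyMatrix, hA]

/-- The block equation says that `∑ A_s H_{t-s} = 0` for `ν < t ≤ L`. -/
theorem sum_mul_eq_zero_of_blockRow {F : Type*} [Field F] {r k : ℕ} (ν L : ℕ)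
    (A : ℕ → Matrix (Fin r) (Fin r) F) (H : ℕ → Matrix (Fin r) (Fin k) F) (hA : A 0 = 1)
    (hAH : blockRow A ν ν * blockHankel H ν L = -blockRow H L (L - ν)) (t : ℕ) (ht : ν < t)
    (htL : t ≤ L) : ∑ s ∈ Finset.range (ν + 1), A s * H (t - s) = 0 := by
  ext i c
  have h := congrFun (congrFun hAH i) (⟨L - t, by omega⟩, c)
  simp only [Matrix.mul_apply, Fintype.sum_prod_type, blockRow, blockHankel, Matrix.of_apply,
    Matrix.neg_apply] at h
  rw [Finset.sum_range_succ', hA, Matrix.add_apply, Matrix.sum_apply, Matrix.one_mul, Matrix.zero_apply,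
    ← eq_neg_iff_add_eq_zero]
  have e1 : L - (L - t) = t - 0 := by omega
  rw [e1] at h
  rw [← h, ← Finset.sum_range_reflect, Finset.sum_range]
  refine Finset.sum_congr rfl fun x _ => ?_
  rw [Matrix.mul_apply]
  have hx := x.2
  refine Finset.sum_congr rfl fun l _ => ?_
  have e2 : ν - 1 - (x : ℕ) + 1 = ν - x := by omega
  have e3 : t - (ν - (x : ℕ)) = L - ν + x - (L - t) := by omega
  rw [e2, e3]

theorem X_pow_dvd_polyMatrix_mul_sub {F : Type*} [Field F] {r k : ℕ} (ν L : ℕ)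
    (A : ℕ → Matrix (Fin r) (Fin r) F) (H B : ℕ → Matrix (Fin r) (Fin k) F) (hA : A 0 = 1)
    (hAH : blockRow A ν ν * blockHankel H ν L = -blockRow H L (L - ν))
    (hB : ∀ i ≤ ν, B i = ∑ j ∈ Finset.range (i + 1), A j * H (i - j)) (i : Fin r) (c : Fin k) :
    X ^ (L + 1) ∣ (polyMatrix A ν * polyMatrix H L - polyMatrix B ν) i c := by
  rw [X_pow_dvd_iff]
  intro t ht
  rw [Matrix.sub_apply, coeff_sub, sub_eq_zero, coeff_polyMatrix, Matrix.mul_apply,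
    finsetSum_coeff]
  have h1 : ∀ l, (polyMatrix A ν i l * polyMatrix H L l c).coeff t =
      ∑ s ∈ Finset.range (t + 1), if s ≤ ν then A s i l * H (t - s) l c else 0 := by
    intro l
    rw [coeff_mul, Finset.Nat.sum_antidiagonal_eq_sum_range_succ_mk]
    refine Finset.sum_congr rfl fun s _ => ?_
    rw [coeff_polyMatrix, coeff_polyMatrix, if_pos (show t - s ≤ L by omega), ite_mul, zero_mul]
  simp only [h1]
  rw [Finset.sum_comm]
  split_ifs with h
  · rw [hB t h, Matrix.sum_apply]
    refine Finset.sum_congr rfl fun s hs => ?_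
    simp only [Finset.mem_range] at hs
    simp only [if_pos (show s ≤ ν by omega), Matrix.mul_apply]
  · have h2 := congrFun (congrFun (sum_mul_eq_zero_of_blockRow ν L A H hA hAH t (by omega)
      (by omega)) i) c
    rw [Matrix.sum_apply, Matrix.zero_apply] at h2
    refine Eq.trans ?_ h2
    symm
    refine Finset.sum_subset_zero_on_sdiff (Finset.range_mono (by omega)) ?_ ?_
    · intro s hs
      simp only [Finset.mem_sdiff, Finset.mem_range] at hs
      exact Finset.sum_eq_zero fun l _ => if_neg (by omega)
    · intro s hs
      simp only [Finset.mem_range] at hs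
      simp only [if_pos (show s ≤ ν by omega), Matrix.mul_apply]

/-- From A·H̄ ≡ B mod z^(L+1) follows A(a + H̄ b) ≡ 0. Multiplying by the adjugate of A and
cancelling det A, which is prime to z, gives a + H̄ b ≡ 0. -/
theorem coeff_relation_of_mem_ker {F : Type*} [Field F] {r k : ℕ} (ν L : ℕ)
    (A : ℕ → Matrix (Fin r) (Fin r) F) (H B : ℕ → Matrix (Fin r) (Fin k) F) (hA : A 0 = 1)
    (hAH : blockRow A ν ν * blockHankel H ν L = -blockRow H L (L - ν))
    (hB : ∀ i ≤ ν, B i = ∑ j ∈ Finset.range (i + 1), A j * H (i - j))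
    (a : Fin r → F[X]) (b : Fin k → F[X])
    (hab : (polyMatrix A ν).mulVec a + (polyMatrix B ν).mulVec b = 0) (t : ℕ) (ht : t ≤ L) :
    coeffVec a t + ∑ s ∈ Finset.range (t + 1), (H (t - s)).mulVec (coeffVec b s) = 0 := by
  set c := a + (polyMatrix H L).mulVec b with hc
  have h1 : (polyMatrix A ν).mulVec c =
      (polyMatrix A ν * polyMatrix H L - polyMatrix B ν).mulVec b := by
    rw [hc, Matrix.mulVec_add, Matrix.mulVec_mulVec, Matrix.sub_mulVec,
      eq_neg_of_add_eq_zero_left hab]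
    abel
  have h2 : ∀ i, X ^ (L + 1) ∣ (polyMatrix A ν).mulVec c i := by
    intro i
    rw [h1, Matrix.mulVec, dotProduct]
    exact Finset.dvd_sum fun l _ =>
      Dvd.dvd.mul_right (X_pow_dvd_polyMatrix_mul_sub ν L A H B hA hAH hB i l) _
  have h3 : ∀ i, X ^ (L + 1) ∣ c i := by
    intro i
    refine (isCoprime_X_pow_det _ (polyMatrix_coeff_zero A hA ν) (L + 1)).dvd_of_dvd_mul_left ?_
    have h4 : (polyMatrix A ν).det * c i =
        (polyMatrix A ν).adjugate.mulVec ((polyMatrix A ν).mulVec c) i := by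
      rw [Matrix.mulVec_mulVec, Matrix.adjugate_mul, Matrix.smul_mulVec, Matrix.one_mulVec]
      rfl
    rw [h4, Matrix.mulVec, dotProduct]
    exact Finset.dvd_sum fun l _ => Dvd.dvd.mul_left (h2 l) _
  ext i
  have h5 := X_pow_dvd_iff.1 (h3 i) t (Nat.lt_succ_of_le ht)
  rw [hc, Pi.add_apply, coeff_add, coeff_mulVec_eq_sum] at h5
  rw [Pi.add_apply, Finset.sum_apply, Pi.zero_apply, ← h5]
  congr 1
  refine Finset.sum_congr rfl fun s _ => ?_
  have : ((polyMatrix H L).map fun f => f.coeff (t - s)) = H (t - s) := by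
    ext l c
    simp [coeff_polyMatrix, show t - s ≤ L by omega]
  rw [this]
  rfl

/-! ### Upper and lower bounds for truncated weights -/

/-- The numbering of the `n` columns of a juxtaposition by the columns of its two parts. -/
def colEquiv {n k : ℕ} (hkn : k ≤ n) : Fin (n - k) ⊕ Fin k ≃ Fin n :=
  finSumFinEquiv.trans (finCongr (Nat.sub_add_cancel hkn))

theorem juxtapose_mulVec {R : Type*} [CommRing R] {n k : ℕ} (hkn : k ≤ n)
    (P : Matrix (Fin (n - k)) (Fin (n - k)) R) (Q : Matrix (Fin (n - k)) (Fin k) R)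
    (v : Fin n → R) : (juxtapose hkn P Q).mulVec v =
      P.mulVec (v ∘ colEquiv hkn ∘ Sum.inl) + Q.mulVec (v ∘ colEquiv hkn ∘ Sum.inr) := by
  have h : juxtapose hkn P Q = (Matrix.fromCols P Q).submatrix id (colEquiv hkn).symm := rfl
  rw [h, Matrix.submatrix_mulVec_equiv, Matrix.fromCols_mulVec]
  rfl

open Classical in
theorem hammingNorm_colEquiv {F : Type*} [Field F] {n k : ℕ} (hkn : k ≤ n) (x : Fin n → F) :
    hammingNorm x = hammingNorm (x ∘ colEquiv hkn ∘ Sum.inl) +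
      hammingNorm (x ∘ colEquiv hkn ∘ Sum.inr) := by
  simp only [hammingNorm, Finset.card_filter]
  rw [← (colEquiv hkn).sum_comp, Fintype.sum_sum_type]
  rfl

open Classical in
theorem truncWeight_eq_add {F : Type*} [Field F] {n k : ℕ} (hkn : k ≤ n) (v : Fin n → F[X])
    (j : ℕ) : truncWeight v j = ∑ i ∈ Finset.range (j + 1),
      (hammingNorm (coeffVec (v ∘ colEquiv hkn ∘ Sum.inl) i) +
        hammingNorm (coeffVec (v ∘ colEquiv hkn ∘ Sum.inr) i)) :=
  Finset.sum_congr rfl fun i _ => hammingNorm_colEquiv hkn (coeffVec v i)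

/-- With u·det P ≡ 1 mod z^(j+1), the word b = u·det P·e_c agrees with a unit vector up to time j,
and the adjugate of P completes it to a kernel element. At worst all (j + 1)(n - k) entries of a are
nonzero. -/
theorem exists_mem_ker_truncWeight_le {F : Type*} [Field F] {n k : ℕ} (hk : 0 < k) (hkn : k ≤ n)
    (P : Matrix (Fin (n - k)) (Fin (n - k)) F[X]) (Q : Matrix (Fin (n - k)) (Fin k) F[X])
    (hP : (P.map fun f => f.coeff 0) = 1) (j : ℕ) :
    ∃ v ∈ LinearMap.ker (juxtapose hkn P Q).mulVecLin, coeffVec v 0 ≠ 0 ∧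
      truncWeight v j ≤ (j + 1) * (n - k) + 1 := by
  classical
  obtain ⟨w, u, huw⟩ := isCoprime_X_pow_det P hP (j + 1)
  set c : Fin k := ⟨0, hk⟩
  set b : Fin k → F[X] := Pi.single c (u * P.det) with hb
  set a : Fin (n - k) → F[X] := -(P.adjugate.mulVec (Q.mulVec (Pi.single c u))) with ha
  set v : Fin n → F[X] := Sum.elim a b ∘ (colEquiv hkn).symm with hv
  have hva : v ∘ colEquiv hkn ∘ Sum.inl = a := by ext; simp [hv]
  have hvb : v ∘ colEquiv hkn ∘ Sum.inr = b := by ext; simp [hv]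
  have hcoeff : ∀ t ≤ j, (u * P.det).coeff t = if t = 0 then 1 else 0 := by
    intro t ht
    have : u * P.det = 1 - w * X ^ (j + 1) := by rw [← huw]; ring
    rw [this, coeff_sub, coeff_mul_X_pow', if_neg (by omega), coeff_one, sub_zero]
  have hbt : ∀ t ≤ j, coeffVec b t = if t = 0 then Pi.single c 1 else 0 := by
    intro t ht
    ext i
    simp only [coeffVec, hb]
    rcases eq_or_ne i c with rfl | hi
    · rw [Pi.single_eq_same, hcoeff t ht]; split_ifs <;> simp
    · rw [Pi.single_eq_of_ne hi]; split_ifs <;> simp [hi]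
  refine ⟨v, ?_, ?_, ?_⟩
  · rw [LinearMap.mem_ker, Matrix.mulVecLin_apply, juxtapose_mulVec, hva, hvb, ha,
      Matrix.mulVec_neg, Matrix.mulVec_mulVec, Matrix.mul_adjugate, Matrix.smul_mulVec,
      Matrix.one_mulVec, hb, neg_add_eq_zero, ← Matrix.mulVec_smul]
    congr 1
    ext1 i
    rcases eq_or_ne i c with rfl | hi
    · simp [mul_comm]
    · simp [hi]
  · intro h0
    have h1 := congrFun (hbt 0 (Nat.zero_le _)) c
    have h2 := congrFun h0 (colEquiv hkn (Sum.inr c))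
    have h3 : coeffVec b 0 c = coeffVec v 0 (colEquiv hkn (Sum.inr c)) := by
      rw [← hvb]; rfl
    rw [h3, h2] at h1
    simp at h1
  · rw [truncWeight_eq_add hkn, hva, hvb, Finset.sum_add_distrib]
    refine Nat.add_le_add ?_ ?_
    · refine (Finset.sum_le_card_nsmul _ _ (n - k) fun i _ => ?_).trans (by simp)
      exact hammingNorm_le_card_fintype.trans (by simp)
    · rw [Finset.sum_eq_single 0]
      · rw [hbt 0 (Nat.zero_le _), if_pos rfl]
        refine (Finset.card_le_card (t := {c}) fun i hi => ?_).trans (by simp)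
        by_contra hic
        simp_all
      · intro i hi hi0
        rw [hbt i (by simpa [Nat.lt_succ_iff] using hi), if_neg hi0, hammingNorm_zero]
      · simp

theorem le_truncWeight_of_mem_ker {R F : Type*} [Field R] [Field F] [Algebra R F] (α : F)
    (E : ℕ) (hN : ∀ f : R[X], f ≠ 0 → f.natDegree < 2 ^ E → aeval α f ≠ 0)
    (n k ν L : ℕ) (hk : 0 < k) (hkn : k < n) (hE : max (n - k) k * L + (n - 1) ≤ E)
    (A : ℕ → Matrix (Fin (n - k)) (Fin (n - k)) F) (B : ℕ → Matrix (Fin (n - k)) (Fin k) F)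
    (hA : A 0 = 1)
    (hAH : blockRow A ν ν * blockHankel (blockH α n k) ν L = -blockRow (blockH α n k) L (L - ν))
    (hB : ∀ i ≤ ν, B i = ∑ j ∈ Finset.range (i + 1), A j * blockH α n k (i - j))
    (v : Fin n → F[X])
    (hv : v ∈ LinearMap.ker (juxtapose hkn.le (polyMatrix A ν) (polyMatrix B ν)).mulVecLin)
    (hv0 : coeffVec v 0 ≠ 0) (j : ℕ) (hj : j ≤ L) :
    (j + 1) * (n - k) + 1 ≤ truncWeight v j := by
  classical
  rw [LinearMap.mem_ker, Matrix.mulVecLin_apply, juxtapose_mulVec] at hv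
  have hrel := coeff_relation_of_mem_ker ν L A _ B hA hAH hB _ _ hv
  rw [truncWeight_eq_add hkn.le]
  refine le_sum_hammingNorm_of_toeplitz α E hN n k L hk hkn hE _ _ hrel ?_ j hj
  intro hb0
  apply hv0
  have ha0 := hrel 0 (Nat.zero_le _)
  simp only [zero_add, Finset.range_one, Finset.sum_singleton, hb0, Matrix.mulVec_zero,
    add_zero] at ha0
  ext s
  obtain ⟨s, rfl⟩ := (colEquiv hkn.le).surjective s
  rcases s with s | s
  · exact congrFun ha0 s
  · exact congrFun hb0 s

/-! ### Column reduced generator matrices -/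

theorem exists_orderEmbedding_det_submatrix_ne_zero {F : Type*} [Field F] {n k : ℕ}
    (Λ : Matrix (Fin n) (Fin k) F) (hΛ : Function.Injective Λ.mulVec) :
    ∃ s : Fin k ↪o Fin n, (Λ.submatrix s id).det ≠ 0 := by
  classical
  have hrank : Λ.rank = k := by
    rw [Matrix.rank, LinearMap.finrank_range_of_inj hΛ]; simp
  obtain ⟨κ, a, ha, hspan, hli⟩ := exists_linearIndependent' F Λ.row
  have : Fintype κ := Fintype.ofInjective a ha
  have hcard : Fintype.card κ = k := by
    rw [← hrank, Matrix.rank_eq_finrank_span_row, ← hspan, finrank_span_eq_card hli]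
  have hS : (Finset.univ.map ⟨a, ha⟩).card = k := by simpa using hcard
  set s := (Finset.univ.map ⟨a, ha⟩).orderEmbOfFin hS with hs
  have hmem : ∀ i, ∃ l, a l = s i := fun i => by
    obtain ⟨l, -, hl⟩ := Finset.mem_map.1 (Finset.orderEmbOfFin_mem _ hS i)
    exact ⟨l, hl⟩
  choose l hl using hmem
  have hlinj : Function.Injective l := fun i j h => s.injective (by rw [← hl, ← hl, h])
  have h2 : LinearIndependent F (Λ.submatrix s id).row := by
    have h3 : (Λ.submatrix s id).row = (Λ.row ∘ a) ∘ l := by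
      ext i c
      change Λ (s i) c = Λ (a (l i)) c
      rw [hl]
    rw [h3]
    exact hli.comp l hlinj
  exact ⟨s, ((Matrix.isUnit_iff_isUnit_det _).1
    (Matrix.linearIndependent_rows_iff_isUnit.1 h2)).ne_zero⟩

theorem natDegree_prod_le_and_coeff {F ι : Type*} [Field F] (S : Finset ι) (f : ι → F[X])
    (d : ι → ℕ) (h : ∀ i ∈ S, (f i).natDegree ≤ d i) :
    (∏ i ∈ S, f i).natDegree ≤ ∑ i ∈ S, d i ∧
      (∏ i ∈ S, f i).coeff (∑ i ∈ S, d i) = ∏ i ∈ S, (f i).coeff (d i) := by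
  classical
  induction S using Finset.induction_on with
  | empty => simp
  | insert a S ha ih =>
    have ih := ih fun i hi => h i (Finset.mem_insert_of_mem hi)
    have h1 := h a (Finset.mem_insert_self _ _)
    rw [Finset.prod_insert ha, Finset.sum_insert ha, Finset.prod_insert ha,
      coeff_mul_add_eq_of_natDegree_le h1 ih.1, ih.2]
    exact ⟨natDegree_mul_le_of_le h1 ih.1, rfl⟩

theorem natDegree_det_le_and_coeff {F : Type*} [Field F] {k : ℕ} (P : Matrix (Fin k) (Fin k) F[X])
    (d : Fin k → ℕ) (h : ∀ s i, (P s i).natDegree ≤ d i) :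
    P.det.natDegree ≤ ∑ i, d i ∧
      P.det.coeff (∑ i, d i) = (Matrix.of fun s i => (P s i).coeff (d i)).det := by
  have hp := fun σ : Equiv.Perm (Fin k) => natDegree_prod_le_and_coeff Finset.univ
    (fun i => P (σ i) i) d (fun i _ => h _ _)
  constructor
  · rw [Matrix.det_apply]
    exact natDegree_sum_le_of_forall_le _ _ fun σ _ => (natDegree_smul_le _ _).trans (hp σ).1
  · rw [Matrix.det_apply, Matrix.det_apply, finsetSum_coeff]
    refine Finset.sum_congr rfl fun σ _ => ?_
    rcases Int.units_eq_one_or (Equiv.Perm.sign σ) with hs | hs <;> simp [hs, (hp σ).2]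

/-- The degree of the `i`-th column of a polynomial matrix. -/
noncomputable def colDegree {F : Type*} [Field F] {n k : ℕ} (G : Matrix (Fin n) (Fin k) F[X])
    (i : Fin k) : ℕ :=
  Finset.univ.sup fun s => (G s i).natDegree

/-- The matrix of the leading coefficients of the columns of a polynomial matrix. -/
noncomputable def leadingMatrix {F : Type*} [Field F] {n k : ℕ}
    (G : Matrix (Fin n) (Fin k) F[X]) : Matrix (Fin n) (Fin k) F :=
  Matrix.of fun s i => (G s i).coeff (colDegree G i)

theorem natDegree_le_colDegree {F : Type*} [Field F] {n k : ℕ} (G : Matrix (Fin n) (Fin k) F[X])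
    (s : Fin n) (i : Fin k) : (G s i).natDegree ≤ colDegree G i :=
  Finset.le_sup (f := fun s => (G s i).natDegree) (Finset.mem_univ s)

/-- The coefficient of a full size minor at the sum of the column degrees is the corresponding minor
of the leading matrix, and some such minor is nonzero. -/
theorem maxMinorDegree_eq_sum_colDegree {F : Type*} [Field F] {n k : ℕ}
    (G : Matrix (Fin n) (Fin k) F[X]) (hG : Function.Injective (leadingMatrix G).mulVec) :
    maxMinorDegree G = ∑ i, colDegree G i := by
  have h := fun s : Fin k ↪o Fin n => natDegree_det_le_and_coeff (G.submatrix s id) (colDegree G)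
    fun _ _ => natDegree_le_colDegree G _ _
  refine le_antisymm (Finset.sup_le fun s _ => (h s).1) ?_
  obtain ⟨s, hs⟩ := exists_orderEmbedding_det_submatrix_ne_zero _ hG
  refine le_trans (le_natDegree_of_ne_zero ?_)
    (Finset.le_sup (f := fun s : Fin k ↪o Fin n => (G.submatrix s id).det.natDegree)
      (Finset.mem_univ s))
  rw [(h s).2]
  exact hs

/-- The predictable degree property of column reduced matrices. -/
theorem coeff_eq_zero_of_leadingMatrix_injective {F : Type*} [Field F] {n k : ℕ}
    (G : Matrix (Fin n) (Fin k) F[X]) (hG : Function.Injective (leadingMatrix G).mulVec)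
    (u : Fin k → F[X]) (d : ℕ) (hd : ∀ s, ∀ t, d < t → (G.mulVec u s).coeff t = 0)
    (i : Fin k) (m : ℕ) (hm : d < m + colDegree G i) : (u i).coeff m = 0 := by
  classical
  set D₀ := ∑ i, ((u i).natDegree + colDegree G i + 1) with hD₀
  -- Descending induction on D, starting beyond all degrees. Once the higher levels vanish, the
  -- coefficient of z^D in G u is the leading matrix applied to the coefficients of level D.
  suffices h : ∀ N D, d < D → D₀ ≤ D + N → ∀ i m, m + colDegree G i = D → (u i).coeff m = 0 from
    h D₀ _ hm (Nat.le_add_left _ _) i m rfl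
  intro N
  induction N with
  | zero =>
    intro D _ hD i m him
    apply coeff_eq_zero_of_natDegree_lt
    have := Finset.single_le_sum (f := fun i => (u i).natDegree + colDegree G i + 1)
      (fun _ _ => Nat.zero_le _) (Finset.mem_univ i)
    omega
  | succ N ih =>
    intro D hdD hD
    have hlarge : ∀ i m, D < m + colDegree G i → (u i).coeff m = 0 := fun i m h =>
      ih _ (hdD.trans h) (by omega) i m rfl
    set w : Fin k → F := fun i => if colDegree G i ≤ D then (u i).coeff (D - colDegree G i) else 0
      with hw
    have hw0 : w = 0 := by
      apply hG
      rw [Matrix.mulVec_zero]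
      ext s
      rw [Pi.zero_apply, ← hd s D hdD, Matrix.mulVec, Matrix.mulVec, dotProduct, dotProduct,
        finsetSum_coeff]
      refine Finset.sum_congr rfl fun i _ => ?_
      rw [coeff_mul]
      have hzero : ∀ p ∈ Finset.HasAntidiagonal.antidiagonal D, p.1 ≠ colDegree G i →
          (G s i).coeff p.1 * (u i).coeff p.2 = 0 := by
        intro p hp hne
        rw [Finset.HasAntidiagonal.mem_antidiagonal] at hp
        rcases lt_or_gt_of_ne hne with h | h
        · rw [hlarge i p.2 (by omega), mul_zero]
        · rw [coeff_eq_zero_of_natDegree_lt ((natDegree_le_colDegree G s i).trans_lt h), zero_mul]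
      by_cases hc : colDegree G i ≤ D
      · rw [Finset.sum_eq_single (colDegree G i, D - colDegree G i)]
        · simp [hw, hc, leadingMatrix]
        · intro p hp hne
          refine hzero p hp fun h => hne ?_
          rw [Finset.HasAntidiagonal.mem_antidiagonal] at hp
          exact Prod.ext h (by simp only; omega)
        · intro h
          exact absurd (Finset.HasAntidiagonal.mem_antidiagonal.2 (Nat.add_sub_cancel' hc)) h
      · rw [Finset.sum_eq_zero]
        · simp [hw, hc]
        · intro p hp
          refine hzero p hp fun h => hc ?_
          rw [Finset.HasAntidiagonal.mem_antidiagonal] at hp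
          omega
    intro i m him
    have := congrFun hw0 i
    simp only [hw, Pi.zero_apply] at this
    rwa [if_pos (by omega), show D - colDegree G i = m by omega] at this

/-- The image of H is a submodule of a free module over a PID, hence projective. So the kernel is a
direct summand, and a projection onto it followed by coordinates is the left inverse. -/
theorem exists_left_invertible_range_eq_ker {R : Type*} [CommRing R] [IsDomain R]
    [IsPrincipalIdealRing R] {r n k : ℕ} (H : Matrix (Fin r) (Fin n) R)
    (hk : Module.finrank R (LinearMap.ker H.mulVecLin) = k) :
    ∃ G : Matrix (Fin n) (Fin k) R, (∃ G' : Matrix (Fin k) (Fin n) R, G' * G = 1) ∧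
      LinearMap.ker H.mulVecLin = LinearMap.range G.mulVecLin := by
  classical
  set f := H.mulVecLin with hf
  obtain ⟨σ, hσ⟩ := Module.projective_lifting_property f.rangeRestrict LinearMap.id
    f.surjective_rangeRestrict
  have hσ' : ∀ y, f (σ y) = y := fun y => congrArg Subtype.val (LinearMap.congr_fun hσ y)
  set π : (Fin n → R) →ₗ[R] LinearMap.ker f :=
    (LinearMap.id - σ ∘ₗ f.rangeRestrict).codRestrict _ (fun v => by
      rw [LinearMap.mem_ker, LinearMap.sub_apply, map_sub, LinearMap.comp_apply, hσ']
      simp) with hπ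
  have hπ' : ∀ v : LinearMap.ker f, π v = v := by
    intro v
    apply Subtype.ext
    have : f.rangeRestrict v = 0 := Subtype.ext v.2
    simp [hπ, this]
  let e : LinearMap.ker f ≃ₗ[R] (Fin k → R) :=
    (Module.finBasisOfFinrankEq R (LinearMap.ker f) hk).equivFun
  have hG : (LinearMap.toMatrix' ((LinearMap.ker f).subtype ∘ₗ e.symm.toLinearMap)).mulVecLin =
      (LinearMap.ker f).subtype ∘ₗ e.symm.toLinearMap := by
    rw [← Matrix.toLin'_apply', Matrix.toLin'_toMatrix']
  refine ⟨LinearMap.toMatrix' ((LinearMap.ker f).subtype ∘ₗ e.symm.toLinearMap),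
    ⟨LinearMap.toMatrix' (e.toLinearMap ∘ₗ π), ?_⟩, ?_⟩
  · rw [← LinearMap.toMatrix'_comp, ← LinearMap.toMatrix'_id]
    congr 1
    refine LinearMap.ext fun u => ?_
    simp [hπ']
  · rw [hG, LinearMap.range_comp, LinearEquiv.range, Submodule.map_top, Submodule.range_subtype]

/-- In a generator matrix with minimal sum of column degrees, a dependency c of the leading columns
would allow a unimodular column operation that lowers the largest column degree involved. -/
theorem exists_column_reduced {F : Type*} [Field F] {n k : ℕ} (𝒞 : Submodule F[X] (Fin n → F[X]))
    (h𝒞 : ∃ G : Matrix (Fin n) (Fin k) F[X], (∃ G' : Matrix (Fin k) (Fin n) F[X], G' * G = 1) ∧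
      𝒞 = LinearMap.range G.mulVecLin) :
    ∃ G : Matrix (Fin n) (Fin k) F[X], (∃ G' : Matrix (Fin k) (Fin n) F[X], G' * G = 1) ∧
      𝒞 = LinearMap.range G.mulVecLin ∧ Function.Injective (leadingMatrix G).mulVec := by
  classical
  obtain ⟨G, ⟨⟨G', hG'⟩, hG⟩, hmin⟩ := WellFounded.has_min
    (measure fun G : Matrix (Fin n) (Fin k) F[X] => ∑ i, colDegree G i).wf
    {G | (∃ G' : Matrix (Fin k) (Fin n) F[X], G' * G = 1) ∧ 𝒞 = LinearMap.range G.mulVecLin} h𝒞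
  refine ⟨G, ⟨G', hG'⟩, hG, ?_⟩
  rw [← Matrix.coe_mulVecLin, injective_iff_map_eq_zero]
  intro c hc
  by_contra hc0
  obtain ⟨j, hj⟩ := Function.ne_iff.1 hc0
  obtain ⟨i₀, hi₀, himax⟩ := Finset.exists_max_image (Finset.univ.filter fun i => c i ≠ 0)
    (colDegree G) ⟨j, by simpa using hj⟩
  simp only [Finset.mem_filter, Finset.mem_univ, true_and] at hi₀ himax
  set D := colDegree G i₀ with hD
  set w : Fin k → F[X] := fun i => C (c i) * X ^ (D - colDegree G i) with hw
  set T : Matrix (Fin k) (Fin k) F[X] := (1 : Matrix (Fin k) (Fin k) F[X]).updateCol i₀ w with hT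
  have hdet : T.det = Polynomial.C (c i₀) := by
    rw [hT, ← Matrix.cramer_apply, Matrix.cramer_one]
    simp [hw, hD]
  have hunit : IsUnit T.det := by
    rw [hdet]; exact isUnit_C.2 (isUnit_iff_ne_zero.2 hi₀)
  have hGT : ∀ s i, (G * T) s i = if i = i₀ then G.mulVec w s else G s i := by
    intro s i
    split_ifs with h
    · subst h
      simp [Matrix.mul_apply, hT, Matrix.mulVec, dotProduct]
    · simp [Matrix.mul_apply, hT, Matrix.updateCol_ne h, Matrix.one_apply]
  have hterm : ∀ s i, (G s i * w i).natDegree ≤ D := by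
    intro s i
    by_cases hci : c i = 0
    · simp [hw, hci]
    · refine natDegree_mul_le.trans ?_
      have h1 := natDegree_le_colDegree G s i
      have h2 := himax i hci
      have h3 : (w i).natDegree ≤ D - colDegree G i := natDegree_C_mul_X_pow_le _ _
      omega
  have hcoeff : ∀ s, (G.mulVec w s).coeff D = 0 := by
    intro s
    have := congrFun hc s
    rw [Matrix.mulVecLin_apply, Matrix.mulVec, dotProduct, Pi.zero_apply] at this
    rw [Matrix.mulVec, dotProduct, finsetSum_coeff]
    refine Eq.trans (Finset.sum_congr rfl fun i _ => ?_) this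
    by_cases hci : c i = 0
    · simp [hw, hci]
    · have h2 := himax i hci
      simp only [hw, leadingMatrix, Matrix.of_apply]
      rw [← mul_assoc, coeff_mul_X_pow', if_pos (Nat.sub_le _ _), coeff_mul_C,
        Nat.sub_sub_self h2]
  have hdeg : ∀ s, (G.mulVec w s).natDegree ≤ D := fun s => by
    rw [Matrix.mulVec, dotProduct]
    exact natDegree_sum_le_of_forall_le _ _ fun i _ => hterm s i
  have hGTinv : (T⁻¹ * G') * (G * T) = 1 := by
    rw [Matrix.mul_assoc, ← Matrix.mul_assoc G', hG', Matrix.one_mul,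
      Matrix.nonsing_inv_mul _ hunit]
  have hmem : G * T ∈ {G : Matrix (Fin n) (Fin k) F[X] | (∃ G' : Matrix (Fin k) (Fin n) F[X], G' * G = 1) ∧
      𝒞 = LinearMap.range G.mulVecLin} := by
    refine ⟨⟨_, hGTinv⟩, ?_⟩
    rw [hG]
    refine le_antisymm ?_ ?_
    · rintro _ ⟨u, rfl⟩
      refine ⟨T⁻¹.mulVec u, ?_⟩
      simp only [Matrix.mulVecLin_apply, Matrix.mulVec_mulVec, Matrix.mul_assoc,
        Matrix.mul_nonsing_inv _ hunit, Matrix.mul_one]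
    · rintro _ ⟨u, rfl⟩
      exact ⟨T.mulVec u, by simp [Matrix.mulVec_mulVec]⟩
  apply hmin _ hmem
  change ∑ i, colDegree (G * T) i < ∑ i, colDegree G i
  have hcol : ∀ i, i ≠ i₀ → colDegree (G * T) i = colDegree G i := by
    intro i hi
    simp only [colDegree, hGT, if_neg hi]
  have hcol₀ : colDegree (G * T) i₀ < D := by
    -- In degree 0 the new column would vanish, which left invertibility forbids.
    rcases Nat.eq_zero_or_pos D with h0 | hpos
    · exfalso
      have hzero : ∀ s, (G * T) s i₀ = 0 := by
        intro s
        have h1 := hcoeff s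
        have h2 := hdeg s
        rw [h0] at h1 h2
        rw [hGT, if_pos rfl, eq_C_of_natDegree_le_zero h2, h1, C_0]
      have := congrFun (congrFun hGTinv i₀) i₀
      rw [Matrix.mul_apply] at this
      simp [hzero] at this
    · refine (Finset.sup_lt_iff hpos).2 fun s _ => ?_
      rw [hGT, if_pos rfl]
      refine lt_of_le_of_ne (hdeg s) fun h => ?_
      have h1 := hcoeff s
      rw [← h, coeff_natDegree, leadingCoeff_eq_zero] at h1
      rw [h1, natDegree_zero] at h
      omega
  refine Finset.sum_lt_sum (fun i _ => ?_) ⟨i₀, Finset.mem_univ _, hcol₀⟩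
  by_cases hi : i = i₀
  · subst hi; exact hcol₀.le
  · exact (hcol i hi).le

/-! ### Dimension counts for the degree and for light codewords -/

/-- The polynomial vector with prescribed coefficients, the `s`-th entry having degree less than
`m s`. -/
noncomputable def polyOfCoeffs {F : Type*} [Field F] {n : ℕ} (m : Fin n → ℕ) :
    ((s : Fin n) → Fin (m s) → F) →ₗ[F] (Fin n → F[X]) :=
  LinearMap.pi fun s => (degreeLT F (m s)).subtype ∘ₗ
    (degreeLTEquiv F (m s)).symm.toLinearMap ∘ₗ LinearMap.proj s

theorem polyOfCoeffs_coeff_eq_zero {F : Type*} [Field F] {n : ℕ} (m : Fin n → ℕ)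
    (x : (s : Fin n) → Fin (m s) → F) (s : Fin n) (t : ℕ) (ht : m s ≤ t) :
    (polyOfCoeffs m x s).coeff t = 0 := by
  have h : polyOfCoeffs m x s ∈ degreeLT F (m s) :=
    ((degreeLTEquiv F (m s)).symm (x s)).2
  exact coeff_eq_zero_of_degree_lt ((mem_degreeLT.1 h).trans_le (by exact_mod_cast ht))

theorem polyOfCoeffs_injective {F : Type*} [Field F] {n : ℕ} (m : Fin n → ℕ) :
    Function.Injective (polyOfCoeffs (F := F) m) := by
  intro x y h
  ext1 s
  exact (degreeLTEquiv F (m s)).symm.injective (Subtype.ext (congrFun h s))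

theorem finrank_pi_pi {F : Type*} [Field F] {n : ℕ} (m : Fin n → ℕ) :
    Module.finrank F ((s : Fin n) → Fin (m s) → F) = ∑ s, m s := by
  rw [Module.finrank_pi_fintype]
  simp

/-- The `F`-linear map reading off the coefficients of a polynomial vector at given positions. -/
noncomputable def coeffsAt {F : Type*} [Field F] {n : ℕ} {κ : Type*} (q : κ → Fin n × ℕ) :
    (Fin n → F[X]) →ₗ[F] (κ → F) :=
  LinearMap.pi fun y => lcoeff F (q y).2 ∘ₗ LinearMap.proj (q y).1

theorem coeff_mulVec_eq_zero {F : Type*} [Field F] {r n : ℕ} (H : Matrix (Fin r) (Fin n) F[X])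
    (v : Fin n → F[X]) (d e : ℕ) (i : Fin r) (hH : ∀ s, (H i s).natDegree ≤ e)
    (hv : ∀ s t, d < t → (v s).coeff t = 0) (t : ℕ) (ht : e + d < t) :
    (H.mulVec v i).coeff t = 0 := by
  rw [Matrix.mulVec, dotProduct, finsetSum_coeff]
  refine Finset.sum_eq_zero fun s _ => ?_
  have h2 : (v s).natDegree ≤ d := natDegree_le_iff_coeff_eq_zero.2 fun N hN => hv s N hN
  exact coeff_eq_zero_of_natDegree_lt ((natDegree_mul_le_of_le (hH s) h2).trans_lt ht)

/-- The degree of a code is at most the sum of the row degrees of a parity check matrix. -/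
theorem sum_colDegree_le {F : Type*} [Field F] {r n k : ℕ} (hn : n = r + k)
    (H : Matrix (Fin r) (Fin n) F[X]) (e : ℕ) (hH : ∀ i s, (H i s).natDegree ≤ e)
    (G : Matrix (Fin n) (Fin k) F[X]) (G' : Matrix (Fin k) (Fin n) F[X]) (hG' : G' * G = 1)
    (hker : LinearMap.ker H.mulVecLin = LinearMap.range G.mulVecLin)
    (hG : Function.Injective (leadingMatrix G).mulVec) :
    ∑ i, colDegree G i ≤ r * e := by
  set d := ∑ i, colDegree G i with hd
  have hle : ∀ i, colDegree G i ≤ d := fun i =>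
    Finset.single_le_sum (fun _ _ => Nat.zero_le _) (Finset.mem_univ i)
  let P : ((s : Fin n) → Fin (d + 1) → F) →ₗ[F] (Fin n → F[X]) := polyOfCoeffs fun _ => d + 1
  let q₁ : Fin r × Fin (d + 1 + e) → Fin r × ℕ := fun y => (y.1, y.2)
  let q₂ : (Σ i : Fin k, Fin (d + 1 - colDegree G i)) → Fin k × ℕ := fun y => (y.1, y.2)
  -- A vector v of degree ≤ d is determined by H v and, on the kernel, by the low coefficients of u
  -- = G' v; the others vanish by the predictable degree property. Comparing dimensions, n(d + 1) ≤
  -- r(d + 1 + e) + k(d + 1) - d.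
  let Φ := (coeffsAt q₁ ∘ₗ (H.mulVecLin).restrictScalars F ∘ₗ P).prod
    (coeffsAt q₂ ∘ₗ (G'.mulVecLin).restrictScalars F ∘ₗ P)
  have hinj : Function.Injective Φ := by
    rw [injective_iff_map_eq_zero]
    intro x hx
    have hx1 : ∀ y, ((H.mulVec (P x)) (q₁ y).1).coeff (q₁ y).2 = 0 := fun y =>
      congrFun (congrArg Prod.fst hx) y
    have hx2 : ∀ y, ((G'.mulVec (P x)) (q₂ y).1).coeff (q₂ y).2 = 0 := fun y =>
      congrFun (congrArg Prod.snd hx) y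
    have hPx : ∀ s t, d < t → (P x s).coeff t = 0 := fun s t ht =>
      polyOfCoeffs_coeff_eq_zero _ x s t ht
    have hmem : P x ∈ LinearMap.ker H.mulVecLin := by
      rw [LinearMap.mem_ker, Matrix.mulVecLin_apply]
      ext i t
      rw [Pi.zero_apply, coeff_zero]
      by_cases ht : t < d + 1 + e
      · exact hx1 (i, ⟨t, ht⟩)
      · exact coeff_mulVec_eq_zero H (P x) d e i (hH i) hPx t (by omega)
    rw [hker] at hmem
    obtain ⟨u, hu⟩ := hmem
    rw [Matrix.mulVecLin_apply] at hu
    have hu' : G'.mulVec (P x) = u := by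
      rw [← hu, Matrix.mulVec_mulVec, hG', Matrix.one_mulVec]
    have hu0 : u = 0 := by
      ext i t
      rw [Pi.zero_apply, coeff_zero]
      by_cases ht : t < d + 1 - colDegree G i
      · rw [← hu']
        exact hx2 ⟨i, ⟨t, ht⟩⟩
      · exact coeff_eq_zero_of_leadingMatrix_injective G hG u d
          (fun s t ht => by rw [hu]; exact hPx s t ht) i t (by have := hle i; omega)
    apply polyOfCoeffs_injective
    rw [map_zero]
    change P x = 0
    rw [← hu, hu0, Matrix.mulVec_zero]
  have hfin := LinearMap.finrank_le_finrank_of_injective hinj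
  rw [finrank_pi_pi, Module.finrank_prod, Module.finrank_fintype_fun_eq_card,
    Module.finrank_fintype_fun_eq_card] at hfin
  simp only [Finset.sum_const, Finset.card_univ, Fintype.card_fin, smul_eq_mul, Fintype.card_prod,
    Fintype.card_sigma] at hfin
  have hsum : ∑ i, (d + 1 - colDegree G i) + d = k * (d + 1) := by
    conv_lhs => rw [add_comm]; enter [1]; rw [hd]
    rw [← Finset.sum_add_distrib, Finset.sum_congr rfl fun i _ =>
      show colDegree G i + (d + 1 - colDegree G i) = d + 1 by have := hle i; omega]
    simp
  subst hn
  nlinarith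

theorem card_support_X_mul {F : Type*} [Field F] (f : F[X]) :
    (X * f).support.card = f.support.card := by
  have h : (X * f).support = f.support.map ⟨Nat.succ, Nat.succ_injective⟩ := by
    ext m
    cases m <;> simp
  rw [h, Finset.card_map]

/-- A kernel is closed under division by z, which preserves the number of nonzero coefficients. -/
theorem exists_shift_mem_ker {F : Type*} [Field F] {r n : ℕ} (H : Matrix (Fin r) (Fin n) F[X])
    (v : Fin n → F[X]) (hv : v ∈ LinearMap.ker H.mulVecLin) (hv0 : v ≠ 0) :
    ∃ v' ∈ LinearMap.ker H.mulVecLin, coeffVec v' 0 ≠ 0 ∧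
      ∀ s, (v' s).support.card = (v s).support.card := by
  induction hN : ∑ s, (v s).natDegree using Nat.strong_induction_on generalizing v with
  | _ N ih =>
  by_cases h0 : coeffVec v 0 = 0
  · set v₁ : Fin n → F[X] := fun s => divX (v s) with hv₁
    have hX : ∀ s, v s = X * v₁ s := fun s => by
      have h1 := X_mul_divX_add (v s)
      rw [show (v s).coeff 0 = 0 from congrFun h0 s, C_0, add_zero] at h1
      exact h1.symm
    have hX' : v = (X : F[X]) • v₁ := funext hX
    have hmem : v₁ ∈ LinearMap.ker H.mulVecLin := by
      rw [LinearMap.mem_ker] at hv ⊢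
      rw [hX', map_smul] at hv
      exact (smul_eq_zero.1 hv).resolve_left X_ne_zero
    have hne : v₁ ≠ 0 := by
      intro h; rw [hX', h, smul_zero] at hv0; exact hv0 rfl
    obtain ⟨s₀, hs₀⟩ := Function.ne_iff.1 hne
    have hdeg : ∀ s, (v₁ s).natDegree ≤ (v s).natDegree := fun s => by
      rw [hv₁, natDegree_divX_eq_natDegree_tsub_one]; exact Nat.sub_le _ _
    have hlt : ∑ s, (v₁ s).natDegree < N := by
      rw [← hN]
      refine Finset.sum_lt_sum (fun s _ => hdeg s) ⟨s₀, Finset.mem_univ _, ?_⟩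
      rw [hX s₀, natDegree_X_mul hs₀]
      exact Nat.lt_succ_self _
    obtain ⟨v', h1, h2, h3⟩ := ih _ hlt v₁ hmem hne rfl
    refine ⟨v', h1, h2, fun s => ?_⟩
    rw [h3, hX s, card_support_X_mul]
  · exact ⟨v, hv, h0, fun _ => rfl⟩

theorem truncWeight_le_sum_card_support {F : Type*} [Field F] {n : ℕ} (v : Fin n → F[X]) (j : ℕ) :
    truncWeight v j ≤ ∑ s, (v s).support.card := by
  classical
  simp only [truncWeight, hammingNorm, Finset.card_filter]
  rw [Finset.sum_comm]
  refine Finset.sum_le_sum fun s _ => ?_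
  rw [← Finset.card_filter]
  refine Finset.card_le_card fun i hi => ?_
  rw [mem_support_iff]
  exact (Finset.mem_filter.1 hi).2

/-- The generalized Singleton bound. -/
theorem exists_truncWeight_le_singleton {F : Type*} [Field F] {r n k : ℕ} (hk : 0 < k)
    (hn : n = r + k) (H : Matrix (Fin r) (Fin n) F[X])
    (G : Matrix (Fin n) (Fin k) F[X]) (G' : Matrix (Fin k) (Fin n) F[X]) (hG' : G' * G = 1)
    (hker : LinearMap.ker H.mulVecLin = LinearMap.range G.mulVecLin) :
    ∃ v ∈ LinearMap.ker H.mulVecLin, coeffVec v 0 ≠ 0 ∧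
      ∀ j, truncWeight v j ≤ r * ((∑ i, colDegree G i) / k + 1) + (∑ i, colDegree G i) + 1 := by
  classical
  set D := ∑ i, colDegree G i with hD
  set d := D / k with hd
  have hDd : D + 1 ≤ k * (d + 1) := by
    have := Nat.lt_mul_div_succ D hk
    exact this
  -- Messages u for which G u has degree ≤ d form a space of dimension at least k(d + 1) - D = e +
  -- 1, so `e` coefficients of G u can be forced to vanish. What remains is n(d + 1) - e = r(d + 1)
  -- + D + 1.
  obtain ⟨e, he⟩ := Nat.exists_eq_add_of_le hDd
  obtain ⟨Q, -, hQ⟩ := Finset.exists_subset_card_eq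
    (s := (Finset.univ : Finset (Fin n × Fin (d + 1)))) (n := e) (by
      simp only [Finset.card_univ, Fintype.card_prod, Fintype.card_fin]
      subst hn
      nlinarith)
  let q : Q → Fin n × ℕ := fun y => (y.1.1, y.1.2)
  let P := polyOfCoeffs (F := F) fun i => d + 1 - colDegree G i
  let Φ := coeffsAt q ∘ₗ (G.mulVecLin).restrictScalars F ∘ₗ P
  have hfin : Module.finrank F (Q → F) <
      Module.finrank F ((i : Fin k) → Fin (d + 1 - colDegree G i) → F) := by
    rw [finrank_pi_pi, Module.finrank_fintype_fun_eq_card, Fintype.card_coe, hQ]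
    have h1 : ∑ i : Fin k, (d + 1) ≤ ∑ i, (colDegree G i + (d + 1 - colDegree G i)) :=
      Finset.sum_le_sum fun i _ => by omega
    rw [Finset.sum_add_distrib (f := fun i => colDegree G i)] at h1
    simp only [Finset.sum_const, Finset.card_univ, Fintype.card_fin, smul_eq_mul] at h1
    omega
  obtain ⟨x, hx, hx0⟩ := Submodule.exists_mem_ne_zero_of_ne_bot
    (LinearMap.ker_ne_bot_of_finrank_lt (f := Φ) hfin)
  set v := G.mulVec (P x) with hv
  have hPx : P x ≠ 0 := fun h => hx0 (polyOfCoeffs_injective _ (by rw [map_zero]; exact h))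
  have hv0 : v ≠ 0 := by
    intro h
    apply hPx
    rw [← Matrix.one_mulVec (P x), ← hG', ← Matrix.mulVec_mulVec, ← hv, h, Matrix.mulVec_zero]
  have hvmem : v ∈ LinearMap.ker H.mulVecLin := by rw [hker]; exact ⟨P x, rfl⟩
  have hvQ : ∀ y ∈ Q, (v y.1).coeff y.2 = 0 := fun y hy => congrFun hx ⟨y, hy⟩
  have hvd : ∀ s t, d < t → (v s).coeff t = 0 := by
    intro s t ht
    rw [hv, Matrix.mulVec, dotProduct, finsetSum_coeff]
    refine Finset.sum_eq_zero fun i _ => ?_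
    by_cases hi : colDegree G i ≤ d
    · have h2 : (P x i).natDegree ≤ d - colDegree G i :=
        natDegree_le_iff_coeff_eq_zero.2 fun N hN =>
          polyOfCoeffs_coeff_eq_zero _ x i N (by omega)
      have h3 := natDegree_mul_le_of_le (natDegree_le_colDegree G s i) h2
      exact coeff_eq_zero_of_natDegree_lt (by omega)
    · have h2 : P x i = 0 := by
        ext N
        exact polyOfCoeffs_coeff_eq_zero _ x i N (by omega)
      rw [h2, mul_zero, coeff_zero]
  have hsupp : ∑ s, (v s).support.card ≤ n * (d + 1) - e := by
    have h1 : (Finset.univ.sigma fun s => (v s).support).card ≤ Qᶜ.card := by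
      refine Finset.card_le_card_of_injOn
        (fun y => (y.1, Fin.ofNat (d + 1) y.2)) ?_ ?_
      · rintro ⟨s, t⟩ hy
        simp only [Finset.coe_sigma, Set.mem_sigma_iff, Finset.mem_coe, Finset.mem_univ, true_and,
          mem_support_iff] at hy
        have ht : t < d + 1 := by
          by_contra h; exact hy (hvd s t (by omega))
        simp only [Finset.coe_compl, Set.mem_compl_iff, Finset.mem_coe]
        intro hyQ
        have := hvQ _ hyQ
        simp only [Fin.val_ofNat, Nat.mod_eq_of_lt ht] at this
        exact hy this
      · rintro ⟨s, t⟩ hy ⟨s', t'⟩ hy' h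
        simp only [Finset.coe_sigma, Set.mem_sigma_iff, Finset.mem_coe, Finset.mem_univ, true_and,
          mem_support_iff] at hy hy'
        have ht : t < d + 1 := by
          by_contra h; exact hy (hvd s t (by omega))
        have ht' : t' < d + 1 := by
          by_contra h; exact hy' (hvd s' t' (by omega))
        have h1 : s = s' := congrArg Prod.fst h
        have h2 : t % (d + 1) = t' % (d + 1) := congrArg (fun y => (y.2 : ℕ)) h
        rw [Nat.mod_eq_of_lt ht, Nat.mod_eq_of_lt ht'] at h2
        rw [h1, h2]
    rw [Finset.card_sigma, Finset.card_compl, hQ] at h1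
    simpa using h1
  obtain ⟨v', h1, h2, h3⟩ := exists_shift_mem_ker H v hvmem hv0
  refine ⟨v', h1, h2, fun j => (truncWeight_le_sum_card_support v' j).trans ?_⟩
  rw [Finset.sum_congr rfl fun s _ => h3 s]
  refine hsupp.trans ?_
  subst hn
  rw [add_mul]
  omega

/-! ### Rank of the kernel and conclusion -/

theorem finrank_ker_juxtapose {R : Type*} [CommRing R] [IsDomain R] [IsPrincipalIdealRing R]
    {n k : ℕ} (hkn : k ≤ n)
    (P : Matrix (Fin (n - k)) (Fin (n - k)) R) (Q : Matrix (Fin (n - k)) (Fin k) R)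
    (hP : P.det ≠ 0) :
    Module.finrank R (LinearMap.ker (juxtapose hkn P Q).mulVecLin) = k := by
  have h1 := Submodule.finrank_quotient_add_finrank
    (LinearMap.ker (juxtapose hkn P Q).mulVecLin)
  rw [LinearEquiv.finrank_eq (juxtapose hkn P Q).mulVecLin.quotKerEquivRange] at h1
  have h2 : Module.finrank R (LinearMap.range P.mulVecLin) = n - k := by
    rw [LinearMap.finrank_range_of_inj]
    · simp
    · rw [injective_iff_map_eq_zero]
      exact fun a ha => Matrix.eq_zero_of_mulVec_eq_zero hP ha
  have h3 : LinearMap.range P.mulVecLin ≤ LinearMap.range (juxtapose hkn P Q).mulVecLin := by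
    rintro _ ⟨a, rfl⟩
    refine ⟨Sum.elim a 0 ∘ (colEquiv hkn).symm, ?_⟩
    rw [Matrix.mulVecLin_apply, juxtapose_mulVec]
    have e1 : (Sum.elim a 0 ∘ (colEquiv hkn).symm) ∘ colEquiv hkn ∘ Sum.inl = a := by
      ext; simp
    have e2 : (Sum.elim a (0 : Fin k → R) ∘ (colEquiv hkn).symm) ∘ colEquiv hkn ∘ Sum.inr = 0 := by
      ext; simp
    rw [e1, e2, Matrix.mulVec_zero, add_zero]
    rfl
  have h4 := Submodule.finrank_mono h3
  have h5 := Submodule.finrank_le (LinearMap.range (juxtapose hkn P Q).mulVecLin)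
  simp only [Module.finrank_fin_fun] at h1 h5
  omega

theorem natDegree_juxtapose_polyMatrix_le {F : Type*} [Field F] {n k : ℕ} (hkn : k ≤ n) (ν : ℕ)
    (A : ℕ → Matrix (Fin (n - k)) (Fin (n - k)) F) (B : ℕ → Matrix (Fin (n - k)) (Fin k) F)
    (i : Fin (n - k)) (s : Fin n) :
    (juxtapose hkn (polyMatrix A ν) (polyMatrix B ν) i s).natDegree ≤ ν := by
  have h : ∀ {m : ℕ} (Y : ℕ → Matrix (Fin (n - k)) (Fin m) F) (c : Fin m),
      (polyMatrix Y ν i c).natDegree ≤ ν := fun Y c =>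
    natDegree_le_iff_coeff_eq_zero.2 fun N hN => by
      rw [coeff_polyMatrix, if_neg (by omega)]
  obtain ⟨s, rfl⟩ := (colEquiv hkn).surjective s
  change (Matrix.fromCols (polyMatrix A ν) (polyMatrix B ν) i
    ((colEquiv hkn).symm (colEquiv hkn s))).natDegree ≤ ν
  rw [Equiv.symm_apply_apply]
  rcases s with s | s
  · exact h A s
  · exact h B s

theorem mainTheorem2 {F : Type*} [Field F] [Fintype F] (p : ℕ) [CharP F p]
    (n k δ ν L M : ℕ) (hk : 0 < k) (hkn : k < n) (hδ : (n - k) ∣ δ)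
    (hν : ν = δ / (n - k)) (hL : L = profileLength n k δ) (hM : M = max (n - k) k)
    (α : F) (hα : IsPrimitiveRoot α (Fintype.card F - 1))
    (hF : p ^ 2 ^ (M * (L + 1) + n - 2) ≤ Fintype.card F) :
    (∃ A : ℕ → Matrix (Fin (n - k)) (Fin (n - k)) F, A 0 = 1 ∧
      blockRow A ν ν * blockHankel (blockH α n k) ν L = -blockRow (blockH α n k) L (L - ν)) ∧
    ∀ (A : ℕ → Matrix (Fin (n - k)) (Fin (n - k)) F) (B : ℕ → Matrix (Fin (n - k)) (Fin k) F),
      A 0 = 1 →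
      blockRow A ν ν * blockHankel (blockH α n k) ν L = -blockRow (blockH α n k) L (L - ν) →
      (∀ i ≤ ν, B i = ∑ j ∈ Finset.range (i + 1), A j * blockH α n k (i - j)) →
      IsMDPCode n k δ
        (LinearMap.ker (juxtapose hkn.le (polyMatrix A ν) (polyMatrix B ν)).mulVecLin) := by
  have : Fact p.Prime := ⟨CharP.char_is_prime F p⟩
  let _ : Algebra (ZMod p) F := ZMod.algebra F p
  have hN := aeval_primitiveRoot_ne_zero p α hα _ hF
  have hδ' : δ = (n - k) * ν := by rw [hν, Nat.mul_div_cancel' hδ]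
  have hLν : L = δ / k + ν := by rw [hL, hν, profileLength]
  -- The minors only need the exponent M L + n - 1; M ≥ 1 supplies it.
  have hE : max (n - k) k * L + (n - 1) ≤ M * (L + 1) + n - 2 := by
    have : 1 ≤ M := hM ▸ hk.trans_le (le_max_right _ _)
    rw [← hM, mul_add]
    omega
  refine ⟨exists_blockRow_mul_eq _
    (blockHankel_mulVec_injective α _ hN n k ν L hk hkn ?_ hE) _, ?_⟩
  · rw [hLν, Nat.add_sub_cancel, mul_comm ν, ← hδ']
    exact Nat.div_mul_le_self _ _
  intro A B hA hAH hB
  set P := polyMatrix A ν with hP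
  set Q := polyMatrix B ν with hQ
  set H := juxtapose hkn.le P Q with hH
  have hlow := le_truncWeight_of_mem_ker α _ hN n k ν L hk hkn hE A B hA hAH hB
  have hP0 := polyMatrix_coeff_zero A hA ν
  have hdet : P.det ≠ 0 := by
    intro h
    have := isCoprime_X_pow_det P hP0 1
    rw [h, pow_one, isCoprime_zero_right] at this
    exact not_isUnit_X this
  obtain ⟨G, ⟨G', hG'⟩, hG, hred⟩ := exists_column_reduced _
    (exists_left_invertible_range_eq_ker H (finrank_ker_juxtapose hkn.le P Q hdet))
  have hn : n = (n - k) + k := by omega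
  have hle : ∑ i, colDegree G i ≤ δ := by
    rw [hδ']
    exact sum_colDegree_le hn H ν (natDegree_juxtapose_polyMatrix_le hkn.le ν A B) G G' hG' hG hred
  have hge : δ ≤ ∑ i, colDegree G i := by
    obtain ⟨v, hv, hv0, hvw⟩ := exists_truncWeight_le_singleton hk hn H G G' hG' hG
    -- At j = L the lower bound is (n - k)(⌊δ/k⌋ + 1) + δ + 1, the Singleton value for degree δ.
    -- Since Δ ≤ δ, the Singleton value for Δ can reach it only if Δ = δ.
    have h1 := (hlow v hv hv0 L le_rfl).trans (hvw L)
    have h2 : (∑ i, colDegree G i) / k ≤ δ / k := Nat.div_le_div_right hle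
    have h3 := Nat.mul_le_mul_left (n - k) h2
    have h4 : (L + 1) * (n - k) = (n - k) * (δ / k) + δ + (n - k) := by rw [hLν, hδ']; ring
    rw [mul_add] at h1
    omega
  refine ⟨⟨G, ⟨G', hG'⟩, hG, ⟨H, rfl⟩, ?_⟩, fun j hj => ?_⟩
  · rw [maxMinorDegree_eq_sum_colDegree G hred]
    exact le_antisymm hle hge
  · obtain ⟨v, hv, hv0, hvw⟩ := exists_mem_ker_truncWeight_le hk hkn.le P Q hP0 j
    have hle : columnDistance (LinearMap.ker H.mulVecLin) j ≤ truncWeight v j :=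
      Nat.sInf_le ⟨v, hv, hv0, rfl⟩
    refine le_antisymm (hle.trans hvw) ?_
    rw [columnDistance]
    -- The light word also shows that the set is nonempty, so the infimum is not the default 0.
    refine le_csInf ⟨truncWeight v j, v, hv, hv0, rfl⟩ ?_
    rintro _ ⟨w, hw, hw0, rfl⟩
    exact hlow w hw hw0 j (hL ▸ hj)
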